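/- Let $d,n\in\mathbb{N}=\{1,2,\dots\}$, $N:=n+1$, and let $\Omega=\{t_1,\dots,t_M\}\subset[0,1)^d$ be a set of $M<N^d$ distinct points. Write $z_j:=(e^{2\pi i (t_j)_1},\dots,e^{2\pi i (t_j)_d})$ and consider the Vandermonde matrix $$A:=\bigl(z_j^{\alpha}\bigr)_{1\le j\le M,\ \alpha\in\{0,\dots,n\}^d}\in\mathbb{C}^{M\times N^d},\qquad \sigma_{\min}(A):=\min_{v\in\mathbb{C}^M,\ \|v\|_2=1}\|A^*v\|_2 .$$ For $t,t'\in[0,1)^d$ let $|t-t'|_{\mathbb{T}}:=\min_{r\in\mathbb{Z}^d}\|t-t'+r\|_\infty$. A subset of $\Omega$ is called a cluster if, modulo $\mathbb{Z}^d$, it is contained in an axis-parallel closed cube of side length $1/N$. Suppose that $\Omega=\bigcup_{l=1}^L\Lambda_l$ is a clustered node configuration, i.e. the $\Lambda_l$ are clusters and $$\rho:=N\min_{1\le l<l'\le L}\ \min_{t\in\Lambda_l,\,t'\in\Lambda_{l'}}|t-t'|_{\mathbb{T}}>1$$ (with $\rho:=\infty$ if $L=1$). Let $\lambda:=\max_l|\Lambda_l|$,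 $$\tau:=N\min_{1\le j<j'\le M}|t_j-t_{j'}|_{\mathbb{T}},\qquad \mathcal{C}:=\max_{1\le j\le M}\ \prod_{t'\in\Omega:\ 0<|t_j-t'|_{\mathbb{T}}\le 1/N}\frac{1}{N|t_j-t'|_{\mathbb{T}}}.$$ If $\lambda=2$, then $\mathcal{C}=1/\tau$, and the condition $$\rho\ \ge\ 12\,d\left(\frac{4}{\tau}\right)^{\frac{1}{d+1}}$$ implies $$\sigma_{\min}(A)\ \ge\ \frac{\tau N^{d/2}}{12\cdot 2^{d/2-1/2}\cdot d^{d/4}} .$$ -/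

import Mathlib

noncomputable section

namespace ClusteredVandermonde

variable {d : ℕ}

/-- The wrap-around distance `min_{r ∈ ℤ^d} ‖t - t' + r‖_∞`
(`Fin d → ℝ` carries the maximum norm). -/
def wrapDist (t t' : Fin d → ℝ) : ℝ :=
  ⨅ r : Fin d → ℤ, ‖t - t' + fun i => (r i : ℝ)‖

/-- `Λ` is a cluster: modulo `ℤ^d`, it is contained in an axis-parallel closed cube of
side length `1 / N`. -/
def IsCluster (N : ℕ) (Λ : Finset (Fin d → ℝ)) : Prop :=
  ∃ a : Fin d → ℝ, ∀ t ∈ Λ, ∃ r : Fin d → ℤ, ∀ i,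
    a i ≤ t i + r i ∧ t i + r i ≤ a i + 1 / (N : ℝ)

/-- The distance of two clusters; it is extended-real valued, so that a minimum over
the empty set is `⊤`. -/
def clusterDist (Λ Λ' : Finset (Fin d → ℝ)) : EReal :=
  ⨅ t ∈ Λ, ⨅ t' ∈ Λ', (wrapDist t t' : EReal)

/-- The normalized minimal cluster separation `ρ`
(equal to `⊤` if there is only one cluster). -/
def clusterSep (N : ℕ) {L : ℕ} (Λ : Fin L → Finset (Fin d → ℝ)) : EReal :=
  (N : EReal) * ⨅ (l : Fin L) (l' : Fin L) (_ : l < l'), clusterDist (Λ l) (Λ l')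

/-- `Ω ⊆ [0,1)^d` is a clustered node configuration with clusters `Λ 0, …, Λ (L - 1)`. -/
structure IsClusteredConfiguration (N : ℕ) (Ω : Finset (Fin d → ℝ)) {L : ℕ}
    (Λ : Fin L → Finset (Fin d → ℝ)) : Prop where
  mem_Ico : ∀ t ∈ Ω, ∀ i, t i ∈ Set.Ico (0 : ℝ) 1
  eq_iUnion : (Ω : Set (Fin d → ℝ)) = ⋃ l, (Λ l : Set (Fin d → ℝ))
  isCluster : ∀ l, IsCluster N (Λ l)
  one_lt_sep : 1 < clusterSep N Λ

/-- The cardinality `λ` of the biggest cluster. -/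
def maxClusterCard {L : ℕ} (Λ : Fin L → Finset (Fin d → ℝ)) : ℕ :=
  Finset.univ.sup fun l => (Λ l).card

open Classical in
/-- The cluster complexity `𝒞`. -/
def clusterComplexity (N : ℕ) (Ω : Finset (Fin d → ℝ)) : ℝ :=
  ⨆ t : Ω, ∏ t' ∈ Ω with 0 < wrapDist (t : Fin d → ℝ) t' ∧
      wrapDist (t : Fin d → ℝ) t' ≤ 1 / (N : ℝ),
    1 / ((N : ℝ) * wrapDist (t : Fin d → ℝ) t')

/-- The normalized minimal separation `τ` of the nodes
(a minimum as soon as there are at least two nodes). -/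
def minSep (N : ℕ) (Ω : Finset (Fin d → ℝ)) : ℝ :=
  (N : ℝ) * sInf {x : ℝ | ∃ t ∈ Ω, ∃ t' ∈ Ω, t ≠ t' ∧ x = wrapDist t t'}

/-- The node `z = exp(2πi t)` on the torus belonging to `t`. -/
def node (t : Fin d → ℝ) : Fin d → ℂ :=
  fun i => Complex.exp (2 * Real.pi * Complex.I * (t i : ℂ))

/-- The multivariate Vandermonde matrix `(z^α)`, with rows indexed by the nodes and columns
by the multi-indices `α ∈ {0, …, n}^d`. -/
def vandermonde (n : ℕ) (Ω : Finset (Fin d → ℝ)) : Matrix Ω (Fin d → Fin (n + 1)) ℂ :=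
  Matrix.of fun t α => ∏ i, node (t : Fin d → ℝ) i ^ (α i : ℕ)

/-- `σ_min(A)`, the minimum of `‖A^* v‖₂` over all unit vectors `v`. -/
def sigmaMin {ι κ : Type*} [Fintype ι] [Fintype κ] (A : Matrix ι κ ℂ) : ℝ :=
  ⨅ v : {v : EuclideanSpace ℂ ι // ‖v‖ = 1},
    ‖WithLp.toLp 2 (A.conjTranspose.mulVec (WithLp.ofLp (v : EuclideanSpace ℂ ι)))‖

end ClusteredVandermonde

end

/-! Put `F = A^*v`, let `τ` be the normalized separation and `s = 12 d (4/τ)^(1/(d+1)) / N`, so that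
`s ≤ ρ/N`. The bound comes from recovering `v` approximately by bounded functionals of `F`.

A normalized product of one long Dirichlet kernel and `d` short ones, taken in each coordinate,
gives a kernel `J` with `J(t,t) = 1` whose coordinate factors decay with order `d + 1`. Seen from a
node, the others fall into grid cells of side `s` with at most two nodes each, and the central cell
contains only its own cluster. The condition on `ρ` therefore makes the sum of `|J|` over the far
nodes at most `τ/6` (`sum_norm_prodKernel_far_le`).

The decay of `J` does not remove the cluster partner. A modulation `a - b z̄_i^M` with `M` about
`N/5` does: it is 1 at the node, 0 at the partner, and its coefficients are at most `5/(4τ)`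
(`exists_separating_modulation`). The modulated kernel sends `v` to `w = v + Ev`, where `E` vanishes
inside clusters and has norm at most `2 · 5/(4τ) · τ/6 = 5/12` by the Schur test. Hence `‖w‖ ≥
(7/12)‖v‖`.

Conversely, `w` combines weighted sums of `F` and of shifts of `F` by `M`, and the weighted Bessel
inequality (`sum_norm_sq_weighted_le`) bounds each by `(13/6)(2/N)^d ‖F‖²`. Comparing both estimates
of `w` gives the theorem. The formula for `𝒞` holds because a node has no neighbour within `1/N`
other than its partner. -/

open scoped ComplexConjugate

namespace ClusteredVandermonde

/-! ### Schur test -/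

section Schur

variable {ι : Type*} [Fintype ι]

/-- Schur test for a symmetric majorant, as a bound for the quadratic form. -/
theorem norm_quadForm_le {H : ι → ι → ℂ} {R : ℝ} (hsymm : ∀ j k, ‖H j k‖ = ‖H k j‖)
    (hR : ∀ j, ∑ k, ‖H j k‖ ≤ R) (u : ι → ℂ) :
    ‖∑ j, ∑ k, conj (u j) * u k * H j k‖ ≤ R * ∑ j, ‖u j‖ ^ 2 := by
  have h1 : ‖∑ j, ∑ k, conj (u j) * u k * H j k‖ ≤
      ∑ j, ∑ k, (‖u j‖ ^ 2 * ‖H j k‖ / 2 + ‖u k‖ ^ 2 * ‖H j k‖ / 2) := by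
    refine (norm_sum_le _ _).trans (Finset.sum_le_sum fun j _ => ?_)
    refine (norm_sum_le _ _).trans (Finset.sum_le_sum fun k _ => ?_)
    rw [norm_mul, norm_mul, RCLike.norm_conj]
    nlinarith [mul_nonneg (sq_nonneg (‖u j‖ - ‖u k‖)) (norm_nonneg (H j k))]
  have h2 : ∑ j, ∑ k, ‖u k‖ ^ 2 * ‖H j k‖ / 2 = ∑ j, ∑ k, ‖u j‖ ^ 2 * ‖H j k‖ / 2 := by
    rw [Finset.sum_comm]
    exact Finset.sum_congr rfl fun j _ => Finset.sum_congr rfl fun k _ => by rw [hsymm]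
  simp_rw [Finset.sum_add_distrib] at h1
  rw [h2, ← Finset.sum_add_distrib] at h1
  refine h1.trans ?_
  rw [Finset.mul_sum]
  refine Finset.sum_le_sum fun j _ => ?_
  rw [← Finset.sum_div, ← Finset.mul_sum]
  nlinarith [mul_le_mul_of_nonneg_left (hR j) (sq_nonneg ‖u j‖)]

/-- Schur test for a symmetric majorant, as a bound for the `ℓ²` norm. -/
theorem sum_norm_sq_mulVec_le {E : ι → ι → ℂ} {h : ι → ι → ℝ} {R : ℝ} (hR0 : 0 ≤ R)
    (hE : ∀ j k, ‖E j k‖ ≤ h j k) (hsymm : ∀ j k, h j k = h k j)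
    (hR : ∀ j, ∑ k, h j k ≤ R) (v : ι → ℂ) :
    ∑ j, ‖∑ k, E j k * v k‖ ^ 2 ≤ R ^ 2 * ∑ j, ‖v j‖ ^ 2 := by
  have h0 : ∀ j k, 0 ≤ h j k := fun j k => (norm_nonneg _).trans (hE j k)
  have h1 : ∀ j, ‖∑ k, E j k * v k‖ ^ 2 ≤ R * ∑ k, h j k * ‖v k‖ ^ 2 := by
    intro j
    have h2 : ‖∑ k, E j k * v k‖ ≤ ∑ k, h j k * ‖v k‖ := by
      refine (norm_sum_le _ _).trans (Finset.sum_le_sum fun k _ => ?_)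
      rw [norm_mul]
      exact mul_le_mul_of_nonneg_right (hE j k) (norm_nonneg _)
    have h3 : (∑ k, h j k * ‖v k‖) ^ 2 ≤ (∑ k, h j k) * ∑ k, h j k * ‖v k‖ ^ 2 :=
      Finset.sum_sq_le_sum_mul_sum_of_sq_le_mul _ (fun k _ => h0 j k)
        (fun k _ => mul_nonneg (h0 j k) (sq_nonneg _)) (fun k _ => le_of_eq (by ring))
    calc _ ≤ (∑ k, h j k * ‖v k‖) ^ 2 := by gcongr
      _ ≤ _ := h3
      _ ≤ _ := mul_le_mul_of_nonneg_right (hR j)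
          (Finset.sum_nonneg fun k _ => mul_nonneg (h0 j k) (sq_nonneg _))
  calc _ ≤ ∑ j, R * ∑ k, h j k * ‖v k‖ ^ 2 := Finset.sum_le_sum fun j _ => h1 j
    _ = R * ∑ k, (∑ j, h k j) * ‖v k‖ ^ 2 := by
        rw [← Finset.mul_sum, Finset.sum_comm]
        congr 1
        refine Finset.sum_congr rfl fun k _ => ?_
        rw [Finset.sum_mul]
        exact Finset.sum_congr rfl fun j _ => by rw [hsymm]
    _ ≤ R * ∑ k, R * ‖v k‖ ^ 2 := by
        gcongr with k
        exact hR k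
    _ = _ := by rw [← Finset.mul_sum]; ring

end Schur

/-! ### Weighted Bessel inequality -/

section Bessel

variable {ι : Type*} [Fintype ι] {d : ℕ}

/-- The kernel `∏ᵢ ∑_{a < K} cₐ (zᵢ z̄'ᵢ)ᵃ` with weights `c`. -/
def prodKernel (c : ℕ → ℝ) (K : ℕ) (z z' : Fin d → ℂ) : ℂ :=
  ∏ i, ∑ a ∈ Finset.range K, (c a : ℂ) * (z i * conj (z' i)) ^ a

/-- The multi-indices in `{0, …, K - 1}^d`. -/
def multiBox (d K : ℕ) : Finset (Fin d → ℕ) :=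
  Fintype.piFinset fun _ => Finset.range K

/-- The monomial `z^α`. -/
def monom (z : Fin d → ℂ) (α : Fin d → ℕ) : ℂ :=
  ∏ i, z i ^ α i

theorem monom_add (z : Fin d → ℂ) (α β : Fin d → ℕ) :
    monom z (α + β) = monom z α * monom z β := by
  simp [monom, pow_add, Finset.prod_mul_distrib]

theorem prodKernel_eq_sum (c : ℕ → ℝ) (K : ℕ) (z z' : Fin d → ℂ) :
    prodKernel c K z z' =
      ∑ α ∈ multiBox d K, ((∏ i, c (α i) : ℝ) : ℂ) * (monom z α * conj (monom z' α)) := by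
  rw [prodKernel, Finset.prod_univ_sum, multiBox]
  refine Finset.sum_congr rfl fun α _ => ?_
  simp only [monom, map_prod, map_pow, Complex.ofReal_prod, ← Finset.prod_mul_distrib, mul_pow]

theorem norm_prodKernel_comm (c : ℕ → ℝ) (K : ℕ) (z z' : Fin d → ℂ) :
    ‖prodKernel c K z z'‖ = ‖prodKernel c K z' z‖ := by
  have : prodKernel c K z z' = conj (prodKernel c K z' z) := by
    simp [prodKernel, map_prod, map_sum, mul_comm]
  rw [this, RCLike.norm_conj]

/-- A weighted Bessel inequality for exponentials with an almost diagonal Gram matrix. -/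
theorem sum_norm_sq_weighted_le (z : ι → Fin d → ℂ) {c : ℕ → ℝ} {K : ℕ} {R C : ℝ}
    (hc0 : ∀ a, 0 ≤ c a) (hcC : ∀ a, c a ≤ C) (hR0 : 0 ≤ R)
    (hR : ∀ j, ∑ k, ‖prodKernel c K (z j) (z k)‖ ≤ R) (g : (Fin d → ℕ) → ℂ) :
    ∑ j, ‖∑ α ∈ multiBox d K, ((∏ i, c (α i) : ℝ) : ℂ) * monom (z j) α * g α‖ ^ 2 ≤
      R * C ^ d * ∑ α ∈ multiBox d K, ‖g α‖ ^ 2 := by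
  set u : ι → ℂ := fun j => ∑ α ∈ multiBox d K, ((∏ i, c (α i) : ℝ) : ℂ) * monom (z j) α * g α
    with hu
  set p : (Fin d → ℕ) → ℝ := fun α => ∏ i, c (α i) with hp
  have hp0 : ∀ α, 0 ≤ p α := fun α => Finset.prod_nonneg fun i _ => hc0 _
  have hpC : ∀ α, p α ≤ C ^ d := fun α => by
    simpa using Finset.prod_le_prod (s := Finset.univ) (fun i _ => hc0 (α i)) fun i _ => hcC (α i)
  set W : (Fin d → ℕ) → ℂ := fun α => ∑ j, conj (u j) * monom (z j) α with hW
  set S : ℝ := ∑ j, ‖u j‖ ^ 2 with hS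
  have hS0 : 0 ≤ S := Finset.sum_nonneg fun _ _ => sq_nonneg _
  -- Duality: `S` is a `p`-weighted pairing of `g` with `W`. After Cauchy–Schwarz, the weighted norm
  -- of `W` is a quadratic form in the kernel matrix, at most `R * S`, and one factor `S` cancels.
  have h1 : (S : ℂ) = ∑ α ∈ multiBox d K, (p α : ℂ) * g α * W α := by
    have : (S : ℂ) = ∑ j, conj (u j) * u j := by
      rw [hS]; push_cast
      exact Finset.sum_congr rfl fun j _ => by rw [← Complex.conj_mul']
    rw [this]
    conv_lhs => enter [2, j]; rw [show u j = ∑ α ∈ multiBox d K, (p α : ℂ) * monom (z j) α * g α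
      from rfl, Finset.mul_sum]
    rw [Finset.sum_comm]
    refine Finset.sum_congr rfl fun α _ => ?_
    rw [hW, Finset.mul_sum]
    exact Finset.sum_congr rfl fun j _ => by ring
  have h2 : S ≤ ∑ α ∈ multiBox d K, p α * (‖g α‖ * ‖W α‖) := by
    have : S = ‖(S : ℂ)‖ := by rw [Complex.norm_real, Real.norm_of_nonneg hS0]
    rw [this, h1]
    refine (norm_sum_le _ _).trans (Finset.sum_le_sum fun α _ => ?_)
    rw [norm_mul, norm_mul, Complex.norm_real, Real.norm_of_nonneg (hp0 α), mul_assoc]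
  have h3 : (∑ α ∈ multiBox d K, p α * (‖g α‖ * ‖W α‖)) ^ 2 ≤
      (∑ α ∈ multiBox d K, p α * ‖g α‖ ^ 2) * ∑ α ∈ multiBox d K, p α * ‖W α‖ ^ 2 :=
    Finset.sum_sq_le_sum_mul_sum_of_sq_le_mul _
      (fun α _ => mul_nonneg (hp0 α) (sq_nonneg _))
      (fun α _ => mul_nonneg (hp0 α) (sq_nonneg _)) (fun α _ => le_of_eq (by ring))
  have h4 : ∑ α ∈ multiBox d K, p α * ‖W α‖ ^ 2 ≤ R * S := by
    have h5 : ((∑ α ∈ multiBox d K, p α * ‖W α‖ ^ 2 : ℝ) : ℂ) =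
        ∑ j, ∑ k, conj (u j) * u k * prodKernel c K (z j) (z k) := by
      push_cast
      simp_rw [prodKernel_eq_sum, Finset.mul_sum]
      rw [Finset.sum_congr rfl fun j _ => Finset.sum_comm, Finset.sum_comm]
      refine Finset.sum_congr rfl fun α _ => ?_
      rw [← Complex.mul_conj', hW]
      simp only [map_sum, map_mul, Complex.conj_conj]
      rw [Finset.sum_mul_sum, Finset.mul_sum]
      refine Finset.sum_congr rfl fun j _ => ?_
      rw [Finset.mul_sum]
      exact Finset.sum_congr rfl fun k _ => by ring
    have h6 := norm_quadForm_le (fun j k => norm_prodKernel_comm c K (z j) (z k)) hR u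
    rw [← h5, Complex.norm_real] at h6
    exact (le_abs_self _).trans h6
  have h7 : ∑ α ∈ multiBox d K, p α * ‖g α‖ ^ 2 ≤ C ^ d * ∑ α ∈ multiBox d K, ‖g α‖ ^ 2 := by
    rw [Finset.mul_sum]
    exact Finset.sum_le_sum fun α _ => mul_le_mul_of_nonneg_right (hpC α) (sq_nonneg _)
  set X := ∑ α ∈ multiBox d K, p α * ‖g α‖ ^ 2
  have hX0 : 0 ≤ X := Finset.sum_nonneg fun α _ => mul_nonneg (hp0 α) (sq_nonneg _)
  have h8 : S * S ≤ R * X * S := by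
    calc S * S = S ^ 2 := by ring
      _ ≤ (∑ α ∈ multiBox d K, p α * (‖g α‖ * ‖W α‖)) ^ 2 := by gcongr
      _ ≤ _ := h3
      _ ≤ X * (R * S) := by gcongr
      _ = _ := by ring
  have h9 : S ≤ R * X := by
    rcases hS0.eq_or_lt with h | h
    · rw [← h]; positivity
    · exact le_of_mul_le_mul_right h8 h
  calc S ≤ R * X := h9
    _ ≤ R * (C ^ d * _) := mul_le_mul_of_nonneg_left h7 hR0
    _ = _ := by ring

end Bessel

/-! ### Stability from approximate interpolation -/

section LowerBound

variable {ι : Type*} [Fintype ι] {d : ℕ}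

theorem prodKernel_self {c : ℕ → ℝ} {K : ℕ} (hc1 : ∑ a ∈ Finset.range K, c a = 1)
    {z : Fin d → ℂ} (hz : ∀ i, ‖z i‖ = 1) : prodKernel c K z z = 1 := by
  have : ∀ i, z i * conj (z i) = 1 := fun i => by simp [Complex.mul_conj', hz i]
  simp only [prodKernel, this, one_pow, mul_one]
  norm_cast
  simp [hc1]

/-- Shifting the data by `β` modulates the kernel by `z̄^β`, so modulated kernel sums can be read
off from `A^*v`. -/
theorem sum_weighted_shift (z : ι → Fin d → ℂ) (c : ℕ → ℝ) (K : ℕ) (v : ι → ℂ)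
    (β : Fin d → ℕ) (x : Fin d → ℂ) :
    ∑ α ∈ multiBox d K, ((∏ i, c (α i) : ℝ) : ℂ) * monom x α *
        ∑ k, v k * conj (monom (z k) (α + β)) =
      ∑ k, conj (monom (z k) β) * prodKernel c K x (z k) * v k := by
  simp_rw [prodKernel_eq_sum, Finset.mul_sum, Finset.sum_mul]
  rw [Finset.sum_comm]
  refine Finset.sum_congr rfl fun k _ => Finset.sum_congr rfl fun α _ => ?_
  rw [monom_add, map_mul]
  ring

/-- Degree budget: the shifted exponents stay in the large box, so only entries of `A^*v` are used.
-/
theorem sum_multiBox_shift_le {K M N : ℕ} (hKN : K + M ≤ N) (i : Fin d)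
    {F : (Fin d → ℕ) → ℝ} (hF : ∀ α, 0 ≤ F α) :
    ∑ α ∈ multiBox d K, F (α + Pi.single i M) ≤ ∑ α ∈ multiBox d N, F α := by
  rw [← Finset.sum_image (f := F) (s := multiBox d K) (g := fun α : Fin d → ℕ => α + (Pi.single i M : Fin d → ℕ))
    (fun α _ β _ h => add_right_cancel h)]
  refine Finset.sum_le_sum_of_subset_of_nonneg ?_ fun α _ _ => hF α
  intro β hβ
  obtain ⟨α, hα, rfl⟩ := Finset.mem_image.1 hβ
  simp only [multiBox, Fintype.mem_piFinset, Finset.mem_range, Pi.add_apply] at hα ⊢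
  intro i'
  have h1 := hα i'
  have h2 : (Pi.single i M : Fin d → ℕ) i' ≤ M := by
    by_cases h : i' = i
    · subst h; simp
    · simp [h]
  omega

theorem monom_single (z : Fin d → ℂ) (i : Fin d) (M : ℕ) :
    monom z (Pi.single i M) = z i ^ M := by
  rw [monom, Finset.prod_eq_single i]
  · simp
  · intro b _ hb; simp [hb]
  · simp

/-- A lower bound for `‖A^* v‖`: if certain bounded linear functionals of `A^* v` recover `v` up to
a perturbation that is dominated by a symmetric matrix with small row sums, then `‖A^* v‖`
controls `‖v‖`. -/
theorem sum_norm_sq_le_of_almost_interpolation (z : ι → Fin d → ℂ) {c : ℕ → ℝ} {K M N : ℕ}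
    {R C κ : ℝ} (hKN : K + M ≤ N) (hc0 : ∀ a, 0 ≤ c a) (hcC : ∀ a, c a ≤ C) (hR0 : 0 ≤ R)
    (hR : ∀ j, ∑ k, ‖prodKernel c K (z j) (z k)‖ ≤ R)
    (dir : ι → Fin d) (a b : ι → ℂ) (ha : ∀ j, ‖a j‖ ≤ κ) (hb : ∀ j, ‖b j‖ ≤ κ)
    (E : ι → ι → ℂ) (hE : ∀ (v : ι → ℂ) j,
      ∑ k, (a j - b j * conj (z k (dir j)) ^ M) * prodKernel c K (z j) (z k) * v k =
        v j + ∑ k, E j k * v k)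
    (h : ι → ι → ℝ) (hEh : ∀ j k, ‖E j k‖ ≤ h j k) (hsymm : ∀ j k, h j k = h k j)
    (hrow : ∀ j, ∑ k, h j k ≤ 5 / 12) (v : ι → ℂ) :
    (7 / 12) ^ 2 * ∑ j, ‖v j‖ ^ 2 ≤ 2 * κ ^ 2 * (1 + d) * (R * C ^ d) *
      ∑ α ∈ multiBox d N, ‖∑ k, v k * conj (monom (z k) α)‖ ^ 2 := by
  set F : (Fin d → ℕ) → ℂ := fun α => ∑ k, v k * conj (monom (z k) α) with hF
  set G : (Fin d → ℕ) → ι → ℂ := fun β j =>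
    ∑ α ∈ multiBox d K, ((∏ i, c (α i) : ℝ) : ℂ) * monom (z j) α * F (α + β) with hG
  set T : ℝ := ∑ α ∈ multiBox d N, ‖F α‖ ^ 2 with hT
  have hC0 : 0 ≤ C := (hc0 0).trans (hcC 0)
  have hbes : ∀ i m, m ≤ M → ∑ j, ‖G (Pi.single i m) j‖ ^ 2 ≤ R * C ^ d * T := by
    intro i m hm
    refine (sum_norm_sq_weighted_le z hc0 hcC hR0 hR _).trans ?_
    refine mul_le_mul_of_nonneg_left ?_ (by positivity)
    exact sum_multiBox_shift_le (by omega) i (F := fun α => ‖F α‖ ^ 2) fun α => sq_nonneg _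
  set w : ι → ℂ := fun j => v j + ∑ k, E j k * v k with hw
  have hwG : ∀ j, w j = a j * G (Pi.single (dir j) 0) j - b j * G (Pi.single (dir j) M) j := by
    intro j
    rw [hw]
    simp only
    rw [← hE v j, hG]
    simp only [hF]
    rw [sum_weighted_shift, sum_weighted_shift, Finset.mul_sum, Finset.mul_sum,
      ← Finset.sum_sub_distrib]
    refine Finset.sum_congr rfl fun k _ => ?_
    rw [monom_single, monom_single, map_pow, map_pow, pow_zero]
    ring
  have hw1 : ∀ j, ‖w j‖ ^ 2 ≤ 2 * κ ^ 2 *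
      (‖G (Pi.single (dir j) 0) j‖ ^ 2 + ∑ i, ‖G (Pi.single i M) j‖ ^ 2) := by
    intro j
    have h1 : ‖w j‖ ≤ κ * (‖G (Pi.single (dir j) 0) j‖ + ‖G (Pi.single (dir j) M) j‖) := by
      rw [hwG]
      refine (norm_sub_le _ _).trans ?_
      rw [norm_mul, norm_mul, mul_add]
      gcongr
      · exact ha j
      · exact hb j
    -- The direction varies with `j`, whereas the Bessel bound needs a fixed shift. Summing over all
    -- directions costs the factor `d`.
    have h2 : ‖G (Pi.single (dir j) M) j‖ ^ 2 ≤ ∑ i, ‖G (Pi.single i M) j‖ ^ 2 :=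
      Finset.single_le_sum (f := fun i => ‖G (Pi.single i M) j‖ ^ 2)
        (fun i _ => sq_nonneg _) (Finset.mem_univ _)
    calc ‖w j‖ ^ 2 ≤ (κ * (‖G (Pi.single (dir j) 0) j‖ + ‖G (Pi.single (dir j) M) j‖)) ^ 2 := by
          gcongr
      _ ≤ 2 * κ ^ 2 * (‖G (Pi.single (dir j) 0) j‖ ^ 2 + ‖G (Pi.single (dir j) M) j‖ ^ 2) := by
          have := mul_nonneg (sq_nonneg κ)
            (sq_nonneg (‖G (Pi.single (dir j) 0) j‖ - ‖G (Pi.single (dir j) M) j‖))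
          nlinarith
      _ ≤ _ := by gcongr
  have hw2 : ∑ j, ‖w j‖ ^ 2 ≤ 2 * κ ^ 2 * (1 + d) * (R * C ^ d) * T := by
    have h0 : ∀ j, G (Pi.single (dir j) 0) j = G 0 j := fun j => by simp
    by_cases hι : Nonempty ι
    swap
    · rw [not_nonempty_iff] at hι
      have : T = 0 := by simp [hT, hF]
      simp [this]
    -- A zero shift is the same in every direction, so the choice of `j₀` is immaterial.
    obtain ⟨j₀⟩ := hι
    calc ∑ j, ‖w j‖ ^ 2 ≤ ∑ j, 2 * κ ^ 2 * (‖G (Pi.single (dir j) 0) j‖ ^ 2 +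
          ∑ i, ‖G (Pi.single i M) j‖ ^ 2) := Finset.sum_le_sum fun j _ => hw1 j
      _ = 2 * κ ^ 2 * (∑ j, ‖G (Pi.single (dir j₀) 0) j‖ ^ 2 +
          ∑ i, ∑ j, ‖G (Pi.single i M) j‖ ^ 2) := by
          rw [← Finset.mul_sum, Finset.sum_add_distrib, Finset.sum_comm (s := Finset.univ (α := ι))]
          simp
      _ ≤ 2 * κ ^ 2 * (R * C ^ d * T + ∑ _i : Fin d, R * C ^ d * T) := by
          gcongr with i
          · exact hbes _ _ (Nat.zero_le _)
          · exact hbes _ _ le_rfl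
      _ = _ := by simp; ring
  have he := sum_norm_sq_mulVec_le (by norm_num) hEh hsymm hrow v
  -- Young's inequality with weights `7/12 + 5/12 = 1`; the `E` term then sums to at most
  -- `(5/12)‖v‖²` and is absorbed.
  have hv : ∀ j, ‖v j‖ ^ 2 ≤ 12 / 7 * ‖w j‖ ^ 2 + 12 / 5 * ‖∑ k, E j k * v k‖ ^ 2 := by
    intro j
    have h1 : ‖v j‖ ≤ ‖w j‖ + ‖∑ k, E j k * v k‖ := by
      have : v j = w j - ∑ k, E j k * v k := by rw [hw]; ring
      rw [this]; exact norm_sub_le _ _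
    calc ‖v j‖ ^ 2 ≤ (‖w j‖ + ‖∑ k, E j k * v k‖) ^ 2 := by gcongr
      _ ≤ _ := by nlinarith [sq_nonneg (5 * ‖w j‖ - 7 * ‖∑ k, E j k * v k‖)]
  have hv2 := Finset.sum_le_sum fun j (_ : j ∈ Finset.univ) => hv j
  rw [Finset.sum_add_distrib, ← Finset.mul_sum, ← Finset.mul_sum] at hv2
  linarith

end LowerBound

/-! ### The localized one-dimensional kernel -/

section Kernel

open Polynomial

/-- `1 + X + ⋯ + X^(m-1)`. -/
noncomputable def geomPoly (m : ℕ) : ℝ[X] := ∑ i ∈ Finset.range m, X ^ i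

/-- The point `exp(2πix)`. -/
noncomputable def unitExp (x : ℝ) : ℂ := Complex.exp (2 * Real.pi * Complex.I * (x : ℂ))

theorem unitExp_eq (x : ℝ) : unitExp x = Complex.exp (((2 * Real.pi * x : ℝ) : ℂ) * Complex.I) := by
  rw [unitExp]; congr 1; push_cast; ring

theorem norm_unitExp (x : ℝ) : ‖unitExp x‖ = 1 := by
  rw [unitExp_eq, Complex.norm_exp_ofReal_mul_I]

theorem unitExp_mul_conj (x y : ℝ) : unitExp x * conj (unitExp y) = unitExp (x - y) := by
  rw [unitExp, unitExp, unitExp, ← Complex.exp_conj, ← Complex.exp_add]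
  congr 1
  simp only [map_mul, Complex.conj_I, Complex.conj_ofReal, map_ofNat, Complex.ofReal_sub]
  ring

theorem unitExp_pow (x : ℝ) (M : ℕ) : unitExp x ^ M = unitExp (M * x) := by
  rw [unitExp, unitExp, ← Complex.exp_nat_mul]
  congr 1; push_cast; ring

theorem unitExp_sub_int (x : ℝ) (r : ℤ) : unitExp (x - r) = unitExp x := by
  rw [unitExp, unitExp, Complex.exp_eq_exp_iff_exists_int]
  exact ⟨-r, by push_cast; ring⟩

/-- The chord has length `2|sin πx|`, to which Jordan's inequality applies. -/
theorem four_mul_abs_le_norm_unitExp_sub_one {x : ℝ} (hx : |x| ≤ 1 / 2) :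
    4 * |x| ≤ ‖unitExp x - 1‖ := by
  have h1 : ‖unitExp x - 1‖ = ‖2 * Real.sin (Real.pi * x)‖ := by
    have := Complex.norm_exp_I_mul_ofReal_sub_one (2 * Real.pi * x)
    rw [unitExp_eq, mul_comm, this]
    congr 3; ring
  rw [h1, norm_mul, Real.norm_eq_abs, Real.norm_eq_abs, abs_two]
  have h2 := Real.mul_abs_le_abs_sin (x := Real.pi * x) (by
    rw [abs_mul, abs_of_pos Real.pi_pos]; nlinarith [Real.pi_pos])
  rw [abs_mul, abs_of_pos Real.pi_pos] at h2
  have h3 : 2 / Real.pi * (Real.pi * |x|) = 2 * |x| := by field_simp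
  linarith

theorem aeval_geomPoly (m : ℕ) (ζ : ℂ) : aeval ζ (geomPoly m) = ∑ i ∈ Finset.range m, ζ ^ i := by
  simp [geomPoly]

theorem norm_aeval_geomPoly_le_inv {x : ℝ} (hx0 : x ≠ 0) (hx : |x| ≤ 1 / 2) (m : ℕ) :
    ‖aeval (unitExp x) (geomPoly m)‖ ≤ 1 / (2 * |x|) := by
  have hx' : 0 < |x| := abs_pos.2 hx0
  rw [aeval_geomPoly, le_div_iff₀ (by positivity)]
  have h1 : ‖(∑ i ∈ Finset.range m, unitExp x ^ i) * (unitExp x - 1)‖ ≤ 2 := by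
    rw [geom_sum_mul]
    refine (norm_sub_le _ _).trans ?_
    rw [norm_pow, norm_unitExp]
    norm_num
  rw [norm_mul] at h1
  have h2 := mul_le_mul_of_nonneg_left (four_mul_abs_le_norm_unitExp_sub_one hx)
    (norm_nonneg (∑ i ∈ Finset.range m, unitExp x ^ i))
  linarith

theorem coeff_geomPoly (m a : ℕ) : (geomPoly m).coeff a = if a < m then 1 else 0 := by
  simp [geomPoly, coeff_X_pow]

theorem coeff_mul_nonneg {p q : ℝ[X]} (hp : ∀ a, 0 ≤ p.coeff a) (hq : ∀ a, 0 ≤ q.coeff a) (a : ℕ) :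
    0 ≤ (p * q).coeff a := by
  rw [coeff_mul]
  exact Finset.sum_nonneg fun x _ => mul_nonneg (hp _) (hq _)

theorem coeff_pow_nonneg {p : ℝ[X]} (hp : ∀ a, 0 ≤ p.coeff a) (k a : ℕ) : 0 ≤ (p ^ k).coeff a := by
  induction k generalizing a with
  | zero => rw [pow_zero, coeff_one]; split_ifs <;> norm_num
  | succ k ih => rw [pow_succ]; exact coeff_mul_nonneg ih hp a

theorem coeff_mul_le_eval_one {p q : ℝ[X]} (hp1 : ∀ a, p.coeff a ≤ 1)
    (hq : ∀ a, 0 ≤ q.coeff a) (a : ℕ) : (p * q).coeff a ≤ q.eval 1 := by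
  rw [mul_comm, coeff_mul, Finset.Nat.sum_antidiagonal_eq_sum_range_succ
    (fun i j => q.coeff i * p.coeff j)]
  calc _ ≤ ∑ k ∈ Finset.range (a + 1), q.coeff k :=
        Finset.sum_le_sum fun k _ => mul_le_of_le_one_right (hq k) (hp1 _)
    _ ≤ ∑ k ∈ Finset.range (max (a + 1) (q.natDegree + 1)), q.coeff k :=
        Finset.sum_le_sum_of_subset_of_nonneg
          (Finset.range_mono (le_max_left _ _)) fun k _ _ => hq k
    _ = _ := by
        rw [eval_eq_sum_range' (n := max (a + 1) (q.natDegree + 1)) (by omega)]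
        simp

/-- The weights of the normalized product of one Dirichlet kernel of length `m` and the `d`-th power
of one of length `m'`. -/
noncomputable def weight (d m m' : ℕ) (a : ℕ) : ℝ :=
  (geomPoly m * geomPoly m' ^ d).coeff a / (m * (m' : ℝ) ^ d)

variable {d m m' K : ℕ}

theorem weight_nonneg (a : ℕ) : 0 ≤ weight d m m' a := by
  have h : ∀ m a, 0 ≤ (geomPoly m).coeff a := fun m a => by
    rw [coeff_geomPoly]; split_ifs <;> norm_num
  exact div_nonneg (coeff_mul_nonneg (h m) (coeff_pow_nonneg (h m') d) a) (by positivity)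

/-- The short factors have total mass `m'^d`, which the normalization cancels. Only the long factor
enters the Bessel constant, so `m ≥ N/2` costs just `2^d`. -/
theorem weight_le (hm : 0 < m) (hm' : 0 < m') (a : ℕ) : weight d m m' a ≤ 1 / m := by
  have h : ∀ m a, 0 ≤ (geomPoly m).coeff a := fun m a => by
    rw [coeff_geomPoly]; split_ifs <;> norm_num
  have h1 := coeff_mul_le_eval_one (p := geomPoly m) (q := geomPoly m' ^ d)
    (fun a => by rw [coeff_geomPoly]; split_ifs <;> norm_num) (coeff_pow_nonneg (h m') d) a
  have h2 : (geomPoly m' ^ d).eval 1 = (m' : ℝ) ^ d := by simp [geomPoly, eval_finsetSum]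
  rw [h2] at h1
  rw [weight, div_le_div_iff₀ (by positivity) (by positivity)]
  have : (0 : ℝ) < m := by exact_mod_cast hm
  nlinarith

theorem natDegree_geomPoly_le (m : ℕ) : (geomPoly m).natDegree ≤ m - 1 := by
  refine natDegree_sum_le_of_forall_le _ _ fun i hi => ?_
  rw [natDegree_X_pow]
  have := Finset.mem_range.1 hi
  omega

theorem sum_weight_mul_pow (hK : (m - 1) + d * (m' - 1) < K) (ζ : ℂ) :
    ∑ a ∈ Finset.range K, (weight d m m' a : ℂ) * ζ ^ a =
      aeval ζ (geomPoly m) / m * (aeval ζ (geomPoly m') / m') ^ d := by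
  have hdeg : (geomPoly m * geomPoly m' ^ d).natDegree < K := by
    refine lt_of_le_of_lt (natDegree_mul_le.trans ?_) hK
    refine add_le_add (natDegree_geomPoly_le m) (natDegree_pow_le.trans ?_)
    exact Nat.mul_le_mul_left _ (natDegree_geomPoly_le m')
  have h1 := aeval_eq_sum_range' hdeg ζ
  rw [map_mul, map_pow] at h1
  rw [div_pow, div_mul_div_comm, h1, Finset.sum_div]
  refine Finset.sum_congr rfl fun a _ => ?_
  rw [weight, Algebra.smul_def]
  push_cast
  simp only [Complex.coe_algebraMap]
  ring

theorem sum_weight (hm : 0 < m) (hm' : 0 < m') (hK : (m - 1) + d * (m' - 1) < K) :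
    ∑ a ∈ Finset.range K, weight d m m' a = 1 := by
  have h := sum_weight_mul_pow hK 1
  have hm1 : (m : ℂ) ≠ 0 := by exact_mod_cast hm.ne'
  have hm2 : (m' : ℂ) ≠ 0 := by exact_mod_cast hm'.ne'
  simp only [one_pow, mul_one, aeval_geomPoly, Finset.sum_const, Finset.card_range, nsmul_eq_mul,
    div_self hm1, div_self hm2] at h
  exact_mod_cast h

theorem norm_sum_weight_le_one (hm : 0 < m) (hm' : 0 < m') (hK : (m - 1) + d * (m' - 1) < K)
    {ζ : ℂ} (hζ : ‖ζ‖ = 1) : ‖∑ a ∈ Finset.range K, (weight d m m' a : ℂ) * ζ ^ a‖ ≤ 1 := by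
  rw [← sum_weight hm hm' hK]
  refine (norm_sum_le _ _).trans (Finset.sum_le_sum fun a _ => ?_)
  rw [norm_mul, norm_pow, hζ, one_pow, mul_one, Complex.norm_real,
    Real.norm_of_nonneg (weight_nonneg a)]

theorem norm_sum_weight_le (hK : (m - 1) + d * (m' - 1) < K)
    {x : ℝ} (hx0 : x ≠ 0) (hx : |x| ≤ 1 / 2) :
    ‖∑ a ∈ Finset.range K, (weight d m m' a : ℂ) * unitExp x ^ a‖ ≤
      1 / (2 * m * |x|) * (1 / (2 * m' * |x|)) ^ d := by
  rw [sum_weight_mul_pow hK, norm_mul, norm_pow, norm_div, norm_div, Complex.norm_natCast,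
    Complex.norm_natCast]
  have h : ∀ m : ℕ, ‖aeval (unitExp x) (geomPoly m)‖ / m ≤ 1 / (2 * m * |x|) := fun m => by
    calc _ ≤ 1 / (2 * |x|) / m :=
          div_le_div_of_nonneg_right (norm_aeval_geomPoly_le_inv hx0 hx m) (Nat.cast_nonneg m)
      _ = _ := by rw [div_div]; ring_nf
  exact mul_le_mul (h m) (pow_le_pow_left₀ (by positivity) (h m') d) (by positivity)
    (by positivity)

end Kernel

/-! ### The wrap-around distance -/

section WrapDist

variable {d : ℕ}

/-- The representative of `t - t'` modulo `ℤ^d` with coordinates in `[-1/2, 1/2]`. -/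
noncomputable def wrapVec (t t' : Fin d → ℝ) : Fin d → ℝ :=
  fun i => t i - t' i - round (t i - t' i)

theorem abs_wrapVec_le (t t' : Fin d → ℝ) (i : Fin d) : |wrapVec t t' i| ≤ 1 / 2 :=
  abs_sub_round _

theorem wrapDist_le (t t' : Fin d → ℝ) (r : Fin d → ℤ) :
    wrapDist t t' ≤ ‖fun i => t i - t' i + (r i : ℝ)‖ :=
  ciInf_le ⟨0, by rintro _ ⟨r, rfl⟩; exact norm_nonneg _⟩ r

/-- Rounding minimizes every coordinate simultaneously, so the infimum is attained. -/
theorem wrapDist_eq (t t' : Fin d → ℝ) : wrapDist t t' = ‖wrapVec t t'‖ := by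
  apply le_antisymm
  · refine (wrapDist_le t t' fun i => -round (t i - t' i)).trans (le_of_eq (congrArg _ ?_))
    ext i
    simp [wrapVec, sub_eq_add_neg]
  · refine le_ciInf fun r => (pi_norm_le_iff_of_nonneg (norm_nonneg _)).2 fun i => ?_
    refine le_trans ?_ (norm_le_pi_norm _ i)
    have := round_le (t i - t' i) (-r i)
    simpa [wrapVec, Real.norm_eq_abs] using this

theorem wrapDist_nonneg (t t' : Fin d → ℝ) : 0 ≤ wrapDist t t' := by
  rw [wrapDist_eq]; exact norm_nonneg _

theorem wrapDist_self (t : Fin d → ℝ) : wrapDist t t = 0 := by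
  rw [wrapDist_eq, norm_eq_zero]; ext i; simp [wrapVec]

theorem wrapDist_le_comm (t t' : Fin d → ℝ) : wrapDist t t' ≤ wrapDist t' t := by
  refine le_ciInf fun r => (wrapDist_le t t' fun i => -r i).trans (le_of_eq ?_)
  rw [← norm_neg]
  congr 1
  ext i
  simp only [Pi.neg_apply, Pi.add_apply, Pi.sub_apply]
  push_cast; ring

theorem wrapDist_comm (t t' : Fin d → ℝ) : wrapDist t t' = wrapDist t' t :=
  (wrapDist_le_comm t t').antisymm (wrapDist_le_comm t' t)

theorem wrapDist_le_half (t t' : Fin d → ℝ) : wrapDist t t' ≤ 1 / 2 := by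
  rw [wrapDist_eq]
  exact (pi_norm_le_iff_of_nonneg (by norm_num)).2 fun i => abs_wrapVec_le t t' i

theorem wrapDist_pos {t t' : Fin d → ℝ} (ht : ∀ i, t i ∈ Set.Ico (0 : ℝ) 1)
    (ht' : ∀ i, t' i ∈ Set.Ico (0 : ℝ) 1) (hne : t ≠ t') : 0 < wrapDist t t' := by
  refine (wrapDist_nonneg t t').lt_of_ne fun h => hne ?_
  rw [wrapDist_eq, eq_comm, norm_eq_zero] at h
  ext i
  have h1 : t i - t' i = round (t i - t' i) := by
    have := congrFun h i
    simp only [wrapVec, Pi.zero_apply] at this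
    linarith
  obtain ⟨a1, a2⟩ := ht i
  obtain ⟨b1, b2⟩ := ht' i
  have h2 : round (t i - t' i) = 0 := by
    have l1 : ((-1 : ℤ) : ℝ) < round (t i - t' i) := by rw [← h1]; push_cast; linarith
    have l2 : (round (t i - t' i) : ℝ) < ((1 : ℤ) : ℝ) := by rw [← h1]; push_cast; linarith
    have := Int.cast_lt.1 l1
    have := Int.cast_lt.1 l2
    omega
  rw [h2] at h1
  simp at h1
  linarith

/-- Two points with close displacements from a third one are close. -/
theorem wrapDist_lt_of_wrapVec {t t' t'' : Fin d → ℝ} {s : ℝ} (hs : 0 < s)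
    (h : ∀ i, |wrapVec t t' i - wrapVec t t'' i| < s) : wrapDist t' t'' < s := by
  refine (wrapDist_le t' t'' fun i => round (t i - t' i) - round (t i - t'' i)).trans_lt ?_
  refine (pi_norm_lt_iff hs).2 fun i => ?_
  have := h i
  rw [Real.norm_eq_abs, ← abs_neg]
  convert this using 2
  simp only [wrapVec]
  push_cast; ring

theorem exists_abs_wrapVec_eq (hd : 1 ≤ d) (t t' : Fin d → ℝ) :
    ∃ i, |wrapVec t t' i| = wrapDist t t' := by
  have : Nonempty (Fin d) := ⟨⟨0, hd⟩⟩
  obtain ⟨i, hi⟩ := Finite.exists_max fun i => |wrapVec t t' i|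
  refine ⟨i, le_antisymm ?_ ?_⟩
  · rw [wrapDist_eq]; exact norm_le_pi_norm (wrapVec t t') i
  · rw [wrapDist_eq]; exact (pi_norm_le_iff_of_nonneg (abs_nonneg _)).2 hi

theorem node_mul_conj (t t' : Fin d → ℝ) (i : Fin d) :
    node t i * conj (node t' i) = unitExp (wrapVec t t' i) := by
  rw [wrapVec, unitExp_sub_int, ← unitExp_mul_conj]; rfl

theorem norm_node (t : Fin d → ℝ) (i : Fin d) : ‖node t i‖ = 1 := norm_unitExp _

end WrapDist

/-! ### Clusters, separation and complexity -/

section Clusters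

variable {d N L : ℕ} {Ω : Finset (Fin d → ℝ)} {Λ : Fin L → Finset (Fin d → ℝ)}

theorem clusterSep_le (hN : 0 < N) {l l' : Fin L} (hl : l ≠ l') {t t' : Fin d → ℝ}
    (ht : t ∈ Λ l) (ht' : t' ∈ Λ l') :
    clusterSep N Λ ≤ (((N : ℝ) * wrapDist t t' : ℝ) : EReal) := by
  wlog h : l < l' generalizing l l' t t'
  · rw [wrapDist_comm]
    exact this hl.symm ht' ht (lt_of_le_of_ne (not_lt.1 h) hl.symm)
  have h1 : (⨅ (l : Fin L) (l' : Fin L) (_ : l < l'), clusterDist (Λ l) (Λ l')) ≤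
      (wrapDist t t' : EReal) :=
    (iInf_le_of_le l (iInf_le_of_le l' (iInf_le_of_le h (iInf_le_of_le t (iInf_le_of_le ht
      (iInf_le_of_le t' (iInf_le_of_le ht' le_rfl)))))))
  rw [clusterSep, EReal.coe_mul]
  refine (mul_le_mul_of_nonneg_left h1 (by positivity)).trans (le_of_eq ?_)
  norm_cast

theorem IsCluster.wrapDist_le {S : Finset (Fin d → ℝ)} (hS : IsCluster N S)
    {t t' : Fin d → ℝ} (ht : t ∈ S) (ht' : t' ∈ S) : wrapDist t t' ≤ 1 / N := by
  obtain ⟨a, ha⟩ := hS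
  obtain ⟨r, hr⟩ := ha t ht
  obtain ⟨r', hr'⟩ := ha t' ht'
  refine (ClusteredVandermonde.wrapDist_le t t' fun i => r i - r' i).trans ?_
  refine (pi_norm_le_iff_of_nonneg (by positivity)).2 fun i => ?_
  rw [Real.norm_eq_abs, abs_le]
  push_cast
  constructor <;> linarith [(hr i).1, (hr i).2, (hr' i).1, (hr' i).2]

/-- Two nodes lie in a common cluster. -/
def SameCluster (Λ : Fin L → Finset (Fin d → ℝ)) (t t' : Fin d → ℝ) : Prop :=
  ∃ l, t ∈ Λ l ∧ t' ∈ Λ l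

theorem SameCluster.symm {t t' : Fin d → ℝ} (h : SameCluster Λ t t') : SameCluster Λ t' t :=
  let ⟨l, h1, h2⟩ := h; ⟨l, h2, h1⟩

namespace IsClusteredConfiguration

theorem exists_mem (h : IsClusteredConfiguration N Ω Λ) {t : Fin d → ℝ} (ht : t ∈ Ω) :
    ∃ l, t ∈ Λ l := by
  have : t ∈ (Ω : Set (Fin d → ℝ)) := ht
  rw [h.eq_iUnion] at this
  simpa using this

theorem mem_of_mem (h : IsClusteredConfiguration N Ω Λ) {t : Fin d → ℝ} {l : Fin L}
    (ht : t ∈ Λ l) : t ∈ Ω := by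
  have : t ∈ (Ω : Set (Fin d → ℝ)) := by
    rw [h.eq_iUnion]
    exact Set.mem_iUnion.2 ⟨l, ht⟩
  exact this

/-- Disjointness follows from the separation: a shared node would have distance zero to itself. -/
theorem index_unique (h : IsClusteredConfiguration N Ω Λ) (hN : 0 < N) {t : Fin d → ℝ}
    {l l' : Fin L} (ht : t ∈ Λ l) (ht' : t ∈ Λ l') : l = l' := by
  by_contra hne
  have h1 := h.one_lt_sep.trans_le (clusterSep_le hN hne ht ht')
  rw [wrapDist_self, mul_zero] at h1
  have h2 : (1 : ℝ) < 0 := by exact_mod_cast h1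
  linarith

theorem sameCluster_trans (h : IsClusteredConfiguration N Ω Λ) (hN : 0 < N) {t t' t'' : Fin d → ℝ}
    (h1 : SameCluster Λ t t') (h2 : SameCluster Λ t' t'') : SameCluster Λ t t'' := by
  obtain ⟨l, a1, a2⟩ := h1
  obtain ⟨l', b1, b2⟩ := h2
  obtain rfl := h.index_unique hN a2 b1
  exact ⟨l, a1, b2⟩

theorem sameCluster_self (h : IsClusteredConfiguration N Ω Λ) {t : Fin d → ℝ} (ht : t ∈ Ω) :
    SameCluster Λ t t :=
  let ⟨l, hl⟩ := h.exists_mem ht; ⟨l, hl, hl⟩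

theorem clusterSep_le_of_not_sameCluster (h : IsClusteredConfiguration N Ω Λ) (hN : 0 < N)
    {t t' : Fin d → ℝ} (ht : t ∈ Ω) (ht' : t' ∈ Ω) (hs : ¬ SameCluster Λ t t') :
    clusterSep N Λ ≤ (((N : ℝ) * wrapDist t t' : ℝ) : EReal) := by
  obtain ⟨l, hl⟩ := h.exists_mem ht
  obtain ⟨l', hl'⟩ := h.exists_mem ht'
  refine clusterSep_le hN (fun hll => hs ?_) hl hl'
  subst hll
  exact ⟨l, hl, hl'⟩

theorem wrapDist_le_of_sameCluster (h : IsClusteredConfiguration N Ω Λ)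
    {t t' : Fin d → ℝ} (hs : SameCluster Λ t t') : wrapDist t t' ≤ 1 / N := by
  obtain ⟨l, h1, h2⟩ := hs
  exact (h.isCluster l).wrapDist_le h1 h2

theorem sameCluster_of_wrapDist_le (h : IsClusteredConfiguration N Ω Λ) (hN : 0 < N)
    {t t' : Fin d → ℝ} (ht : t ∈ Ω) (ht' : t' ∈ Ω) (hw : wrapDist t t' ≤ 1 / N) :
    SameCluster Λ t t' := by
  by_contra hs
  have h1 := h.one_lt_sep.trans_le (h.clusterSep_le_of_not_sameCluster hN ht ht' hs)
  have h2 : (1 : ℝ) < N * wrapDist t t' := by exact_mod_cast h1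
  have hN' : (0 : ℝ) < N := by exact_mod_cast hN
  rw [le_div_iff₀ hN'] at hw
  linarith

/-- A set of nodes from a common cluster has at most as many elements as the biggest cluster. -/
theorem card_le_of_sameCluster (h : IsClusteredConfiguration N Ω Λ) (hN : 0 < N)
    {S : Finset (Fin d → ℝ)} (hS : ∀ t ∈ S, ∀ t' ∈ S, SameCluster Λ t t') :
    S.card ≤ maxClusterCard Λ := by
  rcases S.eq_empty_or_nonempty with rfl | ⟨t, ht⟩
  · simp
  obtain ⟨l, hl, -⟩ := hS t ht t ht
  refine (Finset.card_le_card (t := Λ l) fun t' ht' => ?_).trans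
    (Finset.le_sup (f := fun l => (Λ l).card) (Finset.mem_univ l))
  obtain ⟨l', h1, h2⟩ := hS t ht t' ht'
  rwa [h.index_unique hN hl h1]

theorem eq_of_sameCluster (h : IsClusteredConfiguration N Ω Λ) (hN : 0 < N)
    (hpair : maxClusterCard Λ = 2) {t t' t'' : Fin d → ℝ} (h1 : SameCluster Λ t t')
    (h2 : SameCluster Λ t t'') (hne1 : t' ≠ t) (hne2 : t'' ≠ t) : t' = t'' := by
  classical
  by_contra hne
  have hc := h.card_le_of_sameCluster hN (S := {t, t', t''}) (by
    have a := h.sameCluster_trans hN h1 h1.symm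
    have b := h.sameCluster_trans hN h1.symm h1
    have c := h.sameCluster_trans hN h2.symm h2
    have e := h.sameCluster_trans hN h1.symm h2
    simp only [Finset.mem_insert, Finset.mem_singleton]
    rintro x (rfl | rfl | rfl) y (rfl | rfl | rfl) <;>
      first | assumption | exact SameCluster.symm (by assumption))
  rw [Finset.card_eq_three.2 ⟨t, t', t'', hne1.symm, hne2.symm, hne, rfl⟩, hpair] at hc
  omega

theorem exists_pair (h : IsClusteredConfiguration N Ω Λ) (hpair : maxClusterCard Λ = 2) :
    ∃ t ∈ Ω, ∃ t' ∈ Ω, t ≠ t' ∧ SameCluster Λ t t' := by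
  have hne : (Finset.univ : Finset (Fin L)).Nonempty := by
    by_contra hc
    rw [Finset.not_nonempty_iff_eq_empty] at hc
    rw [maxClusterCard, hc] at hpair
    simp at hpair
  obtain ⟨l, -, hl⟩ := Finset.exists_mem_eq_sup _ hne fun l => (Λ l).card
  rw [maxClusterCard, hl] at hpair
  obtain ⟨t, t', hne, hS⟩ := Finset.card_eq_two.1 hpair
  have h1 : t ∈ Λ l := by simp [hS]
  have h2 : t' ∈ Λ l := by simp [hS]
  exact ⟨t, h.mem_of_mem h1, t', h.mem_of_mem h2, hne, l, h1, h2⟩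

theorem minSep_spec (h : IsClusteredConfiguration N Ω Λ) (hpair : maxClusterCard Λ = 2) :
    (∃ t ∈ Ω, ∃ t' ∈ Ω, t ≠ t' ∧ minSep N Ω = N * wrapDist t t') ∧
      ∀ t ∈ Ω, ∀ t' ∈ Ω, t ≠ t' → minSep N Ω ≤ N * wrapDist t t' := by
  set S := {x : ℝ | ∃ t ∈ Ω, ∃ t' ∈ Ω, t ≠ t' ∧ x = wrapDist t t'} with hS
  have hfin : S.Finite := by
    refine ((Ω ×ˢ Ω).finite_toSet.image fun p => wrapDist p.1 p.2).subset ?_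
    rintro x ⟨t, ht, t', ht', -, rfl⟩
    exact ⟨(t, t'), by simp [ht, ht'], rfl⟩
  have hne : S.Nonempty := by
    obtain ⟨t, ht, t', ht', hne, -⟩ := h.exists_pair hpair
    exact ⟨_, t, ht, t', ht', hne, rfl⟩
  constructor
  · obtain ⟨t, ht, t', ht', hne, hx⟩ := hne.csInf_mem hfin
    exact ⟨t, ht, t', ht', hne, by rw [minSep, hx]⟩
  · intro t ht t' ht' hne
    exact mul_le_mul_of_nonneg_left (csInf_le hfin.bddBelow ⟨t, ht, t', ht', hne, rfl⟩)
      (Nat.cast_nonneg N)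

theorem minSep_pos (h : IsClusteredConfiguration N Ω Λ) (hN : 0 < N)
    (hpair : maxClusterCard Λ = 2) : 0 < minSep N Ω := by
  obtain ⟨t, ht, t', ht', hne, he⟩ := (h.minSep_spec hpair).1
  rw [he]
  exact mul_pos (by exact_mod_cast hN) (wrapDist_pos (h.mem_Ico t ht) (h.mem_Ico t' ht') hne)

theorem minSep_le_one (h : IsClusteredConfiguration N Ω Λ) (hN : 0 < N)
    (hpair : maxClusterCard Λ = 2) : minSep N Ω ≤ 1 := by
  obtain ⟨t, ht, t', ht', hne, hs⟩ := h.exists_pair hpair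
  have h1 := h.wrapDist_le_of_sameCluster hs
  have hN' : (0 : ℝ) < N := by exact_mod_cast hN
  rw [le_div_iff₀ hN'] at h1
  linarith [(h.minSep_spec hpair).2 t ht t' ht' hne]

-- Each product has at most one factor, that of the cluster partner. An empty product is harmless
-- since `τ ≤ 1`, and a closest pair attains the maximum.
open Classical in
theorem clusterComplexity_eq (h : IsClusteredConfiguration N Ω Λ) (hN : 0 < N)
    (hpair : maxClusterCard Λ = 2) : clusterComplexity N Ω = 1 / minSep N Ω := by
  have hN' : (0 : ℝ) < N := by exact_mod_cast hN
  have hτ := h.minSep_pos hN hpair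
  have hτ1 := h.minSep_le_one hN hpair
  obtain ⟨⟨t₀, ht₀, t₁, ht₁, hne, he⟩, hmin⟩ := h.minSep_spec hpair
  have hfilter : ∀ t ∈ Ω, ∀ t' ∈ Ω, t ≠ t' → wrapDist t t' ≤ 1 / N →
      {t' ∈ Ω | 0 < wrapDist t t' ∧ wrapDist t t' ≤ 1 / (N : ℝ)} = {t'} := by
    intro t ht t' ht' hne hw
    ext x
    simp only [Finset.mem_filter, Finset.mem_singleton]
    constructor
    · rintro ⟨hx, hx0, hx1⟩
      refine h.eq_of_sameCluster hN hpair (h.sameCluster_of_wrapDist_le hN ht hx hx1)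
        (h.sameCluster_of_wrapDist_le hN ht ht' hw) ?_ hne.symm
      rintro rfl
      rw [wrapDist_self] at hx0
      exact hx0.false
    · rintro rfl
      exact ⟨ht', wrapDist_pos (h.mem_Ico t ht) (h.mem_Ico _ ht') hne, hw⟩
  have hle : ∀ t : Ω, ∏ t' ∈ Ω with 0 < wrapDist (t : Fin d → ℝ) t' ∧
      wrapDist (t : Fin d → ℝ) t' ≤ 1 / (N : ℝ), 1 / ((N : ℝ) * wrapDist (t : Fin d → ℝ) t') ≤
      1 / minSep N Ω := by
    rintro ⟨t, ht⟩
    by_cases hc : ∃ t' ∈ Ω, t ≠ t' ∧ wrapDist t t' ≤ 1 / N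
    · obtain ⟨t', ht', hne, hw⟩ := hc
      simp only
      rw [hfilter t ht t' ht' hne hw, Finset.prod_singleton]
      exact one_div_le_one_div_of_le hτ (hmin t ht t' ht' hne)
    · rw [Finset.prod_eq_one]
      · rw [le_div_iff₀ hτ]; linarith
      · intro t' ht'
        obtain ⟨a, b, c⟩ := Finset.mem_filter.1 ht'
        refine absurd ⟨t', a, ?_, c⟩ hc
        rintro rfl
        rw [wrapDist_self] at b
        exact absurd b (lt_irrefl _)
  have : Nonempty Ω := ⟨⟨t₀, ht₀⟩⟩
  apply le_antisymm
  · exact ciSup_le hle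
  · refine le_trans (le_of_eq ?_) (le_ciSup (f := fun t : Ω => ∏ t' ∈ Ω with
      0 < wrapDist (t : Fin d → ℝ) t' ∧ wrapDist (t : Fin d → ℝ) t' ≤ 1 / (N : ℝ),
      1 / ((N : ℝ) * wrapDist (t : Fin d → ℝ) t')) ⟨_, Set.forall_mem_range.2 hle⟩ ⟨t₀, ht₀⟩)
    simp only
    rw [hfilter t₀ ht₀ t₁ ht₁ hne, Finset.prod_singleton, he]
    rw [le_div_iff₀ hN', mul_comm, ← he]
    exact hτ1

end IsClusteredConfiguration

end Clusters

/-! ### Kernel sums over far nodes -/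

section Decay

/-- The majorant `1` at `0` and `B / ν ^ 2` at `ν ≠ 0`. -/
noncomputable def invSqMajorant (B : ℝ) (ν : ℤ) : ℝ := if ν = 0 then 1 else B / (ν : ℝ) ^ 2

theorem invSqMajorant_nonneg {B : ℝ} (hB : 0 ≤ B) (ν : ℤ) : 0 ≤ invSqMajorant B ν := by
  rw [invSqMajorant]; split_ifs <;> positivity

theorem sum_invSqMajorant_le {B : ℝ} (hB : 0 ≤ B) (R : ℕ) :
    ∑ ν ∈ Finset.Icc (-(R : ℤ)) R, invSqMajorant B ν ≤ 1 + 4 * B := by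
  have heven : Function.Even (invSqMajorant B) := fun ν => by simp [invSqMajorant]
  rw [Finset.sum_Icc_of_even_eq_range heven, Finset.sum_range_succ']
  have h1 : ∑ i ∈ Finset.range R, invSqMajorant B ((i + 1 : ℕ) : ℤ) ≤ 2 * B := by
    have h2 := sum_Ioo_inv_sq_le (α := ℝ) 0 (R + 1)
    have h3 : ∑ i ∈ Finset.range R, invSqMajorant B ((i + 1 : ℕ) : ℤ) =
        B * ∑ i ∈ Finset.Ioo 0 (R + 1), ((i : ℝ) ^ 2)⁻¹ := by
      rw [show Finset.Ioo 0 (R + 1) = Finset.Ico 1 (R + 1) by ext; simp; omega,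
        Finset.sum_Ico_eq_sum_range, Finset.mul_sum]
      refine Finset.sum_congr rfl fun i _ => ?_
      rw [invSqMajorant, if_neg (by omega)]
      push_cast
      rw [div_eq_mul_inv, add_comm (1 : ℝ)]
    rw [h3]
    norm_num at h2
    nlinarith
  have h4 : invSqMajorant B ((0 : ℕ) : ℤ) = 1 := by simp [invSqMajorant]
  rw [h4, nsmul_eq_mul]
  have h5 : invSqMajorant B 0 = 1 := by simp [invSqMajorant]
  rw [h5]
  push_cast at h1 ⊢
  linarith

/-- Summing a product majorant over points with nonzero integer labels, each label occurring at
most twice. -/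
theorem sum_prod_invSqMajorant_le {ι : Type*} {d : ℕ} {B : ℝ} (hB : 0 ≤ B) (S : Finset ι)
    (μ : ι → Fin d → ℤ) (hμ0 : ∀ k ∈ S, μ k ≠ 0)
    (hμ2 : ∀ ν : Fin d → ℤ, {k ∈ S | μ k = ν}.card ≤ 2) :
    ∑ k ∈ S, ∏ i, invSqMajorant B (μ k i) ≤ 2 * ((1 + 4 * B) ^ d - 1) := by
  classical
  -- `R` only confines the labels to a finite box; the final bound does not depend on it.
  set R : ℕ := ∑ k ∈ S, ∑ i, (μ k i).natAbs with hR
  set T : Finset (Fin d → ℤ) := Fintype.piFinset fun _ => Finset.Icc (-(R : ℤ)) R with hT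
  have hmem : ∀ k ∈ S, μ k ∈ T.erase 0 := by
    intro k hk
    refine Finset.mem_erase.2 ⟨hμ0 k hk, Fintype.mem_piFinset.2 fun i => ?_⟩
    have h1 : (μ k i).natAbs ≤ R :=
      (Finset.single_le_sum (f := fun i => (μ k i).natAbs) (fun _ _ => Nat.zero_le _)
        (Finset.mem_univ i)).trans (Finset.single_le_sum
          (f := fun k => ∑ i, (μ k i).natAbs) (fun _ _ => Nat.zero_le _) hk)
    rw [Finset.mem_Icc]
    omega
  have h0 : ∀ ν : Fin d → ℤ, 0 ≤ ∏ i, invSqMajorant B (ν i) := fun ν =>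
    Finset.prod_nonneg fun i _ => invSqMajorant_nonneg hB _
  have h0T : (0 : Fin d → ℤ) ∈ T := Fintype.mem_piFinset.2 fun i => by simp
  rw [← Finset.sum_fiberwise_of_maps_to hmem]
  -- Once all nonzero labels of the box are admitted, the sum factors over the coordinates, up to
  -- the term of label zero.
  calc _ ≤ ∑ ν ∈ T.erase 0, 2 * ∏ i, invSqMajorant B (ν i) := by
        refine Finset.sum_le_sum fun ν _ => ?_
        rw [Finset.sum_congr rfl fun k hk => by rw [(Finset.mem_filter.1 hk).2],
          Finset.sum_const, nsmul_eq_mul]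
        exact mul_le_mul_of_nonneg_right (by exact_mod_cast hμ2 ν) (h0 ν)
    _ = 2 * ((∑ ν ∈ Finset.Icc (-(R : ℤ)) R, invSqMajorant B ν) ^ d - 1) := by
        rw [← Finset.mul_sum, Finset.sum_erase_eq_sub h0T, hT]
        congr 2
        · have := Finset.prod_univ_sum (fun _ : Fin d => Finset.Icc (-(R : ℤ)) R)
            fun _ ν => invSqMajorant B ν
          rw [← this]
          simp
        · simp [invSqMajorant]
    _ ≤ _ := by
        have := sum_invSqMajorant_le hB R
        have h3 : 0 ≤ ∑ ν ∈ Finset.Icc (-(R : ℤ)) R, invSqMajorant B ν :=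
          Finset.sum_nonneg fun ν _ => invSqMajorant_nonneg hB ν
        gcongr

/-- A nonzero label satisfies `|ν| s / 2 ≤ |x|`, and the factors 2 in the Dirichlet bounds absorb
the half. Of the decay order `d + 1`, only 2 is kept, enough for summability. -/
theorem norm_sum_weight_le_invSqMajorant {d m m' K : ℕ} (hd : 1 ≤ d) (hm : 0 < m) (hm' : 0 < m')
    (hK : (m - 1) + d * (m' - 1) < K) {x s : ℝ} (hx : |x| ≤ 1 / 2) (hs : 0 < s) :
    ‖∑ a ∈ Finset.range K, (weight d m m' a : ℂ) * unitExp x ^ a‖ ≤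
      invSqMajorant (1 / ((m * s) * (m' * s) ^ d)) (round (x / s)) := by
  have hm1 : (0 : ℝ) < m := by exact_mod_cast hm
  have hm2 : (0 : ℝ) < m' := by exact_mod_cast hm'
  rw [invSqMajorant]
  split_ifs with h0
  · exact norm_sum_weight_le_one hm hm' hK (norm_unitExp x)
  set ν := round (x / s) with hν
  have h1 : (1 : ℝ) ≤ |(ν : ℝ)| := by
    rw [← Int.cast_abs]
    exact_mod_cast Int.one_le_abs h0
  have h2 : |(ν : ℝ)| * s / 2 ≤ |x| := by
    have h3 : |x / s - ν| ≤ 1 / 2 := abs_sub_round _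
    have h4 : |(ν : ℝ)| ≤ |x / s| + 1 / 2 := by
      have := abs_sub_abs_le_abs_sub (ν : ℝ) (x / s)
      rw [abs_sub_comm] at this
      linarith
    rw [abs_div, abs_of_pos hs] at h4
    have h5 : |(ν : ℝ)| / 2 ≤ |x| / s := by linarith
    rw [le_div_iff₀ hs] at h5
    linarith
  have hx0 : x ≠ 0 := by
    rintro rfl
    rw [abs_zero] at h2
    nlinarith
  refine (norm_sum_weight_le hK hx0 hx).trans ?_
  have hb : ∀ m : ℕ, 0 < m → 1 / (2 * m * |x|) ≤ 1 / ((m * s) * |(ν : ℝ)|) := fun m hm => by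
    have hm1 : (0 : ℝ) < m := by exact_mod_cast hm
    refine one_div_le_one_div_of_le (by positivity) ?_
    nlinarith
  calc _ ≤ 1 / ((m * s) * |(ν : ℝ)|) * (1 / ((m' * s) * |(ν : ℝ)|)) ^ d :=
        mul_le_mul (hb m hm) (pow_le_pow_left₀ (by positivity) (hb m' hm') d) (by positivity)
          (by positivity)
    _ = 1 / ((m * s) * (m' * s) ^ d) / |(ν : ℝ)| ^ (d + 1) := by
        rw [one_div_pow, mul_pow, pow_succ, one_div_mul_one_div, div_div]
        congr 1; ring
    _ ≤ 1 / ((m * s) * (m' * s) ^ d) / |(ν : ℝ)| ^ 2 := by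
        gcongr
        omega
    _ = _ := by rw [sq_abs]

theorem abs_sub_lt_of_round_eq {x y s : ℝ} (hs : 0 < s) (h : round (x / s) = round (y / s)) :
    |x - y| < s := by
  rw [round_eq, round_eq] at h
  have := Int.abs_sub_lt_one_of_floor_eq_floor h
  rw [show x / s + 1 / 2 - (y / s + 1 / 2) = (x - y) / s by ring, abs_div, abs_of_pos hs,
    div_lt_one hs] at this
  exact this

theorem abs_lt_of_round_eq_zero {x s : ℝ} (hs : 0 < s) (h : round (x / s) = 0) : |x| < s := by
  simpa using abs_sub_lt_of_round_eq (x := x) (y := 0) hs (by simpa using h)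

theorem norm_prodKernel_weight_le_one {d m m' K : ℕ} (hm : 0 < m) (hm' : 0 < m')
    (hK : (m - 1) + d * (m' - 1) < K) (t t' : Fin d → ℝ) :
    ‖prodKernel (weight d m m') K (node t) (node t')‖ ≤ 1 := by
  rw [prodKernel, norm_prod]
  refine Finset.prod_le_one (fun _ _ => norm_nonneg _) fun i _ => ?_
  rw [node_mul_conj]
  exact norm_sum_weight_le_one hm hm' hK (norm_unitExp _)

/-- The localized kernel has a small sum over the nodes outside of a cluster. -/
theorem sum_norm_prodKernel_far_le {d N L m m' K : ℕ} {Ω : Finset (Fin d → ℝ)}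
    {Λ : Fin L → Finset (Fin d → ℝ)} (h : IsClusteredConfiguration N Ω Λ) (hN : 0 < N)
    (hpair : maxClusterCard Λ = 2) (hd : 1 ≤ d) (hm : 0 < m) (hm' : 0 < m')
    (hK : (m - 1) + d * (m' - 1) < K) {s : ℝ} (hs : 0 < s)
    (hsep : ∀ t ∈ Ω, ∀ t' ∈ Ω, ¬ SameCluster Λ t t' → s ≤ wrapDist t t')
    {t : Fin d → ℝ} (ht : t ∈ Ω) (S : Finset Ω) (hS : ∀ k ∈ S, ¬ SameCluster Λ t (k : Fin d → ℝ)) :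
    ∑ k ∈ S, ‖prodKernel (weight d m m') K (node t) (node k)‖ ≤
      2 * ((1 + 4 * (1 / ((m * s) * (m' * s) ^ d))) ^ d - 1) := by
  classical
  -- Cells of side `s` around `t`: label zero means distance below `s` from `t`, and equal labels
  -- mean mutual distance below `s`. Either forces a common cluster.
  set μ : Ω → Fin d → ℤ := fun k i => round (wrapVec t k i / s) with hμ
  refine le_trans (Finset.sum_le_sum fun k _ => ?_)
    (sum_prod_invSqMajorant_le (by positivity) S μ ?_ ?_)
  · rw [prodKernel, norm_prod]
    refine Finset.prod_le_prod (fun _ _ => norm_nonneg _) fun i _ => ?_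
    rw [node_mul_conj]
    exact norm_sum_weight_le_invSqMajorant hd hm hm' hK (abs_wrapVec_le _ _ _) hs
  · intro k hk h0
    refine (hsep t ht k k.2 (hS k hk)).not_gt ?_
    rw [wrapDist_eq, pi_norm_lt_iff hs]
    exact fun i => abs_lt_of_round_eq_zero hs (congrFun h0 i)
  · intro ν
    have hcard := h.card_le_of_sameCluster hN
      (S := {k ∈ S | μ k = ν}.map (Function.Embedding.subtype _)) (by
        intro x hx y hy
        obtain ⟨k, hk, rfl⟩ := Finset.mem_map.1 hx
        obtain ⟨k', hk', rfl⟩ := Finset.mem_map.1 hy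
        by_contra hc
        refine (hsep k k.2 k' k'.2 hc).not_gt (wrapDist_lt_of_wrapVec (t := t) hs fun i => ?_)
        refine abs_sub_lt_of_round_eq hs ?_
        exact congrFun ((Finset.mem_filter.1 hk).2.trans (Finset.mem_filter.1 hk').2.symm) i)
    rw [Finset.card_map, hpair] at hcard
    exact hcard

end Decay

/-! ### Separating partners and assembling the bound -/

section Main

variable {d N L : ℕ} {Ω : Finset (Fin d → ℝ)} {Λ : Fin L → Finset (Fin d → ℝ)}

namespace IsClusteredConfiguration

/-- Coefficients of a two-term modulation which is `1` at a node and `0` at the other node of its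
cluster. -/
theorem exists_separating_modulation (h : IsClusteredConfiguration N Ω Λ) (hN : 0 < N)
    (hpair : maxClusterCard Λ = 2) (hd : 1 ≤ d) {M : ℕ} (hM5 : N ≤ 5 * M) (hM2 : 2 * M ≤ N)
    {t : Fin d → ℝ} (ht : t ∈ Ω) :
    ∃ (i : Fin d) (a b : ℂ), ‖a‖ ≤ 5 / (4 * minSep N Ω) ∧ ‖b‖ ≤ 5 / (4 * minSep N Ω) ∧
      a - b * conj (node t i) ^ M = 1 ∧
      ∀ t' ∈ Ω, SameCluster Λ t t' → t' ≠ t → a - b * conj (node t' i) ^ M = 0 := by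
  have hτ := h.minSep_pos hN hpair
  have hτ1 := h.minSep_le_one hN hpair
  have hN' : (0 : ℝ) < N := by exact_mod_cast hN
  by_cases hp : ∃ p ∈ Ω, SameCluster Λ t p ∧ p ≠ t
  swap
  · refine ⟨⟨0, hd⟩, 1, 0, ?_, ?_, by simp, fun t' h1 h2 h3 => absurd ⟨t', h1, h2, h3⟩ hp⟩
    · rw [norm_one, le_div_iff₀ (by positivity)]; linarith
    · rw [norm_zero]; positivity
  obtain ⟨p, hpΩ, hps, hpt⟩ := hp
  obtain ⟨i, hi⟩ := exists_abs_wrapVec_eq hd t p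
  have hw1 := h.wrapDist_le_of_sameCluster hps
  have hw2 := (h.minSep_spec hpair).2 t ht p hpΩ hpt.symm
  set D : ℂ := conj (node p i) ^ M - conj (node t i) ^ M with hD
  -- With `x` the displacement in the coordinate realizing the distance, `‖D‖ = |exp(2πiMx) - 1| ≥
  -- 4M|x|`. Here `M ≤ N/2` and `|x| ≤ 1/N` permit the chord bound, while `M ≥ N/5` and `|x| ≥ τ/N`
  -- give the constant.
  have hnorm : 4 * minSep N Ω / 5 ≤ ‖D‖ := by
    have h1 : D = conj (node t i) ^ M * (unitExp (M * wrapVec t p i) - 1) := by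
      have h2 : conj (node t i) * node t i = 1 := by
        rw [Complex.conj_mul', norm_node]; norm_num
      rw [← unitExp_pow, ← node_mul_conj, mul_sub, ← mul_pow, ← mul_assoc, h2, one_mul, mul_one]
    have h3 : |(M : ℝ) * wrapVec t p i| = M * wrapDist t p := by
      rw [abs_mul, hi, abs_of_nonneg (Nat.cast_nonneg M)]
    have hM2' : 2 * (M : ℝ) ≤ N := by exact_mod_cast hM2
    have hM5' : (N : ℝ) ≤ 5 * M := by exact_mod_cast hM5
    have hw0 := wrapDist_nonneg t p
    rw [le_div_iff₀ hN'] at hw1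
    have h4 := four_mul_abs_le_norm_unitExp_sub_one (x := M * wrapVec t p i) (by
      rw [h3]; nlinarith)
    rw [h1, norm_mul, norm_pow, RCLike.norm_conj, norm_node, one_pow, one_mul]
    rw [h3] at h4
    nlinarith
  have hD0 : D ≠ 0 := by
    intro h0
    rw [h0, norm_zero] at hnorm
    linarith
  have hinv : ‖D⁻¹‖ ≤ 5 / (4 * minSep N Ω) := by
    rw [norm_inv, inv_le_comm₀ (norm_pos_iff.2 hD0) (by positivity), inv_div]
    exact hnorm
  refine ⟨i, D⁻¹ * conj (node p i) ^ M, D⁻¹, ?_, hinv, ?_, ?_⟩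
  · rwa [norm_mul, norm_pow, RCLike.norm_conj, norm_node, one_pow, mul_one]
  · rw [← mul_sub]
    exact inv_mul_cancel₀ hD0
  · intro t' _ h2 h3
    rw [h.eq_of_sameCluster hN hpair h2 hps h3 hpt, sub_self]

theorem card_sameCluster_le (h : IsClusteredConfiguration N Ω Λ) (hN : 0 < N)
    (hpair : maxClusterCard Λ = 2) (t : Fin d → ℝ) (S : Finset Ω)
    (hS : ∀ k ∈ S, SameCluster Λ t (k : Fin d → ℝ)) : S.card ≤ 2 := by
  have hcard := h.card_le_of_sameCluster hN (S := S.map (Function.Embedding.subtype _)) (by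
    intro x hx y hy
    obtain ⟨k, hk, rfl⟩ := Finset.mem_map.1 hx
    obtain ⟨k', hk', rfl⟩ := Finset.mem_map.1 hy
    exact h.sameCluster_trans hN (hS k hk).symm (hS k' hk'))
  rwa [Finset.card_map, hpair] at hcard

open Classical in
/-- The lower bound for `‖A^* v‖`, given a localized kernel. -/
theorem sum_norm_sq_le (h : IsClusteredConfiguration N Ω Λ) (hN : 0 < N)
    (hpair : maxClusterCard Λ = 2) (hd : 1 ≤ d) {M K m m' : ℕ} (hM5 : N ≤ 5 * M) (hM2 : 2 * M ≤ N)
    (hKN : K + M ≤ N) (hm2 : N ≤ 2 * m) (hm' : 0 < m')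
    (hK : (m - 1) + d * (m' - 1) < K)
    (hfar : ∀ t ∈ Ω, ∑ k ∈ Finset.univ.filter fun k : Ω => ¬ SameCluster Λ t (k : Fin d → ℝ),
      ‖prodKernel (weight d m m') K (node t) (node (k : Fin d → ℝ))‖ ≤ minSep N Ω / 6)
    (v : Ω → ℂ) :
    (7 / 12) ^ 2 * ∑ j, ‖v j‖ ^ 2 ≤
      2 * (5 / (4 * minSep N Ω)) ^ 2 * (1 + d) * (13 / 6 * (2 / (N : ℝ)) ^ d) *
        ∑ α ∈ multiBox d N, ‖∑ k : Ω, v k * conj (monom (node (k : Fin d → ℝ)) α)‖ ^ 2 := by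
  have hτ := h.minSep_pos hN hpair
  have hτ1 := h.minSep_le_one hN hpair
  have hN' : (0 : ℝ) < N := by exact_mod_cast hN
  have hm : 0 < m := by omega
  set κ := 5 / (4 * minSep N Ω) with hκ
  choose dir a b ha hb hab1 hab0 using fun j : Ω =>
    h.exists_separating_modulation hN hpair hd hM5 hM2 j.2
  set J : Ω → Ω → ℂ := fun j k =>
    prodKernel (weight d m m') K (node (j : Fin d → ℝ)) (node (k : Fin d → ℝ)) with hJ
  have hJ1 : ∀ j k, ‖J j k‖ ≤ 1 := fun j k => norm_prodKernel_weight_le_one hm hm' hK _ _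
  have hJself : ∀ j, J j j = 1 := fun j =>
    prodKernel_self (sum_weight hm hm' hK) fun i => norm_node _ i
  refine sum_norm_sq_le_of_almost_interpolation (fun j : Ω => node (j : Fin d → ℝ))
    (c := weight d m m') (K := K) (M := M) hKN
    weight_nonneg (fun x => (weight_le hm hm' x).trans ?_) (by norm_num) (fun j => ?_)
    dir a b ha hb
    (fun j k => (a j - b j * conj (node (k : Fin d → ℝ) (dir j)) ^ M) * J j k -
      if k = j then 1 else 0) (fun v j => ?_)
    -- The coefficients depend on `j`, so `E` need not be symmetric in modulus; this majorant is.
    (fun j k => if SameCluster Λ (j : Fin d → ℝ) k then 0 else 2 * κ * ‖J j k‖)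
    (fun j k => ?_) (fun j k => ?_) (fun j => ?_) v
  · rw [div_le_div_iff₀ (by exact_mod_cast hm) hN']
    exact_mod_cast (by omega : 1 * N ≤ 2 * m)
  -- At most two cluster terms of size at most 1, plus `τ/6 ≤ 1/6`, give `13/6`.
  · rw [← Finset.sum_filter_add_sum_filter_not Finset.univ
      (fun k : Ω => SameCluster Λ (j : Fin d → ℝ) k)]
    have h1 : ∑ k ∈ Finset.univ.filter fun k : Ω => SameCluster Λ (j : Fin d → ℝ) k, ‖J j k‖ ≤ 2 := by
      refine (Finset.sum_le_card_nsmul _ _ 1 fun k _ => hJ1 j k).trans ?_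
      rw [nsmul_eq_mul, mul_one]
      exact_mod_cast h.card_sameCluster_le hN hpair j _ fun k hk => (Finset.mem_filter.1 hk).2
    have h2 := hfar j j.2
    simp only [hJ] at h1
    linarith
  · simp only [sub_mul, Finset.sum_sub_distrib, ite_mul, one_mul, zero_mul, Finset.sum_ite_eq',
      Finset.mem_univ, if_true, hJ]
    ring
  · split_ifs with hjk hs hs
    · subst hjk
      rw [hab1, hJself]; simp
    · subst hjk
      exact absurd (h.sameCluster_self k.2) hs
    · rw [hab0 j k k.2 hs fun hc => hjk (Subtype.ext hc)]; simp
    · rw [sub_zero, norm_mul]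
      refine mul_le_mul_of_nonneg_right ((norm_sub_le _ _).trans ?_) (norm_nonneg _)
      rw [norm_mul, norm_pow, RCLike.norm_conj, norm_node, one_pow, mul_one]
      linarith [ha j, hb j]
  · rw [show ‖J j k‖ = ‖J k j‖ from norm_prodKernel_comm _ _ _ _]
    by_cases hs : SameCluster Λ (j : Fin d → ℝ) k
    · rw [if_pos hs, if_pos hs.symm]
    · rw [if_neg hs, if_neg fun hc => hs hc.symm]
  · rw [← Finset.sum_filter_not_add_sum_filter Finset.univ
      (fun k : Ω => SameCluster Λ (j : Fin d → ℝ) k),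
      Finset.sum_congr rfl fun k hk => if_neg (Finset.mem_filter.1 hk).2,
      Finset.sum_congr rfl fun k hk => if_pos (Finset.mem_filter.1 hk).2,
      Finset.sum_const_zero, add_zero, ← Finset.mul_sum]
    calc 2 * κ * _ ≤ 2 * κ * (minSep N Ω / 6) := by
          gcongr
          exact hfar j j.2
      _ = 5 / 12 := by rw [hκ]; field_simp; norm_num

end IsClusteredConfiguration

/-! ### Constants and the final estimate -/

theorem two_mul_one_add_pow_sub_one_le {d : ℕ} (hd : 1 ≤ d) {τ B : ℝ} (hτ0 : 0 < τ) (hτ1 : τ ≤ 1)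
    (hB0 : 0 ≤ B) (hB : B ≤ τ / (72 * d)) : 2 * ((1 + 4 * B) ^ d - 1) ≤ τ / 6 := by
  have hd' : (0 : ℝ) < d := by exact_mod_cast hd
  -- Since `4dB ≤ τ/18` and `exp x - 1 ≤ x + x²` for small `x`, the left side is at most `τ/9 +
  -- τ²/162 ≤ τ/6`.
  have h1 : (1 + 4 * B) ^ d ≤ Real.exp (τ / 18) := by
    calc (1 + 4 * B) ^ d ≤ Real.exp (4 * B) ^ d := by
          gcongr
          linarith [Real.add_one_le_exp (4 * B)]
      _ = Real.exp (d * (4 * B)) := by rw [← Real.exp_nat_mul]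
      _ ≤ _ := by
          refine Real.exp_le_exp.2 ?_
          rw [le_div_iff₀ (by positivity)] at hB
          linarith
  have h2 := abs_le.1 (Real.abs_exp_sub_one_sub_id_le (x := τ / 18) (by
    rw [abs_of_pos (by positivity)]; linarith))
  nlinarith [h2.2]

/-- The decay constant of the localized kernel. -/
theorem kernel_const_le {d N m m' : ℕ} (hd : 1 ≤ d) (hN : 0 < N) (hm2 : N ≤ 2 * m)
    (hm' : N ≤ 4 * (d * m')) {τ Q : ℝ} (hτ : 0 < τ) (hQ0 : 0 < Q) (hQ : Q ^ (d + 1) = 4 / τ) :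
    1 / ((m * (12 * d * Q / N)) * (m' * (12 * d * Q / N)) ^ d) ≤ τ / (72 * d) := by
  have hN' : (0 : ℝ) < N := by exact_mod_cast hN
  have hd' : (1 : ℝ) ≤ d := by exact_mod_cast hd
  have h1 : 6 * d * Q ≤ m * (12 * d * Q / N) := by
    rw [mul_div_assoc', le_div_iff₀ hN']
    have : (N : ℝ) ≤ 2 * m := by exact_mod_cast hm2
    nlinarith [mul_le_mul_of_nonneg_left this (by positivity : 0 ≤ 6 * d * Q)]
  have h2 : 3 * Q ≤ m' * (12 * d * Q / N) := by
    rw [mul_div_assoc', le_div_iff₀ hN']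
    have : (N : ℝ) ≤ 4 * (d * m') := by exact_mod_cast hm'
    nlinarith [mul_le_mul_of_nonneg_left this (by positivity : 0 ≤ 3 * Q)]
  have h3 : 72 * d / τ ≤ (m * (12 * d * Q / N)) * (m' * (12 * d * Q / N)) ^ d := by
    calc 72 * d / τ = 18 * d * Q ^ (d + 1) := by rw [hQ]; ring
      _ = (6 * d * Q) * (3 * Q ^ d) := by ring
      _ ≤ (6 * d * Q) * (3 * Q) ^ d := by
          rw [mul_pow]
          gcongr
          exact le_self_pow₀ (by norm_num) (by omega)
      _ ≤ _ := by gcongr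
  calc _ ≤ 1 / (72 * d / τ) := one_div_le_one_div_of_le (by positivity) h3
    _ = _ := by rw [one_div_div]

/-- Lets the square of `d^(d/4)` absorb the factor `1 + d ≤ 2d` from the sum over directions. -/
theorem natCast_le_rpow_half {d : ℕ} (hd : 1 ≤ d) : (d : ℝ) ≤ (d : ℝ) ^ ((d : ℝ) / 2) := by
  rcases hd.eq_or_lt with rfl | h
  · simp
  · have h1 : (1 : ℝ) ≤ d := by exact_mod_cast hd
    have h2 : (2 : ℝ) ≤ d := by exact_mod_cast h
    conv_lhs => rw [← Real.rpow_one (d : ℝ)]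
    exact Real.rpow_le_rpow_of_exponent_le h1 (by linarith)

theorem sq_bound_eq {d N : ℕ} (τ : ℝ) :
    (τ * (N : ℝ) ^ ((d : ℝ) / 2) /
      (12 * (2 : ℝ) ^ ((d : ℝ) / 2 - 1 / 2) * (d : ℝ) ^ ((d : ℝ) / 4))) ^ 2 =
      τ ^ 2 * (N : ℝ) ^ d / (72 * 2 ^ d * (d : ℝ) ^ ((d : ℝ) / 2)) := by
  have hsq : ∀ x y : ℝ, 0 ≤ x → (x ^ y) ^ 2 = x ^ (y * 2) := fun x y hx => by
    rw [Real.rpow_mul hx, Real.rpow_two]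
  rw [div_pow, mul_pow, mul_pow, mul_pow, hsq _ _ (Nat.cast_nonneg N), hsq _ _ (by norm_num),
    hsq _ _ (Nat.cast_nonneg d), show (d : ℝ) / 2 * 2 = (d : ℕ) by ring, Real.rpow_natCast,
    show ((d : ℝ) / 2 - 1 / 2) * 2 = (d : ℕ) - 1 by ring, Real.rpow_sub_one (by norm_num),
    Real.rpow_natCast, show (d : ℝ) / 4 * 2 = (d : ℝ) / 2 by ring]
  congr 1
  ring

theorem norm_sq_conjTranspose_mulVec (n : ℕ) (v : EuclideanSpace ℂ Ω) :
    ‖WithLp.toLp 2 ((vandermonde n Ω).conjTranspose.mulVec (WithLp.ofLp v))‖ ^ 2 =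
      ∑ α ∈ multiBox d (n + 1),
        ‖∑ k : Ω, v k * conj (monom (node (k : Fin d → ℝ)) α)‖ ^ 2 := by
  rw [EuclideanSpace.norm_sq_eq]
  refine Finset.sum_bij (fun α _ i => (α i : ℕ)) ?_ ?_ ?_ ?_
  · intro α _
    exact Fintype.mem_piFinset.2 fun i => Finset.mem_range.2 (α i).2
  · intro α _ β _ hαβ
    ext i
    exact congrFun hαβ i
  · intro α hα
    refine ⟨fun i => ⟨α i, Finset.mem_range.1 (Fintype.mem_piFinset.1 hα i)⟩, Finset.mem_univ _, rfl⟩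
  · intro α _
    congr 2
    simp only [Matrix.mulVec, dotProduct, Matrix.conjTranspose_apply, vandermonde, Matrix.of_apply,
      monom]
    exact Finset.sum_congr rfl fun k _ => mul_comm _ _

/-- The lower bound for the smallest singular value for clusters of at most two nodes. -/
theorem le_sigmaMin_vandermonde_of_pairs {d n L : ℕ} (hd : 1 ≤ d) (hn : 1 ≤ n)
    {Ω : Finset (Fin d → ℝ)} {Λ : Fin L → Finset (Fin d → ℝ)}
    (h : IsClusteredConfiguration (n + 1) Ω Λ) (hpair : maxClusterCard Λ = 2)
    (hρ : ((12 * (d : ℝ) * (4 / minSep (n + 1) Ω) ^ (1 / ((d : ℝ) + 1)) : ℝ) : EReal) ≤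
      clusterSep (n + 1) Λ) :
    minSep (n + 1) Ω * ((n + 1 : ℕ) : ℝ) ^ ((d : ℝ) / 2) /
        (12 * (2 : ℝ) ^ ((d : ℝ) / 2 - 1 / 2) * (d : ℝ) ^ ((d : ℝ) / 4)) ≤
      sigmaMin (vandermonde n Ω) := by
  classical
  obtain ⟨N, hNn⟩ : ∃ N, N = n + 1 := ⟨_, rfl⟩
  suffices hmain : minSep N Ω * (N : ℝ) ^ ((d : ℝ) / 2) /
      (12 * (2 : ℝ) ^ ((d : ℝ) / 2 - 1 / 2) * (d : ℝ) ^ ((d : ℝ) / 4)) ≤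
      sigmaMin (vandermonde n Ω) by rwa [hNn] at hmain
  rw [← hNn] at h hρ
  have hN : 0 < N := by omega
  have hN' : (0 : ℝ) < N := by exact_mod_cast hN
  have hd' : (1 : ℝ) ≤ d := by exact_mod_cast hd
  have hτ := h.minSep_pos hN hpair
  have hτ1 := h.minSep_le_one hN hpair
  set τ := minSep N Ω with hτdef
  set Q : ℝ := (4 / τ) ^ (1 / ((d : ℝ) + 1)) with hQdef
  have h4τ : 1 ≤ 4 / τ := by rw [le_div_iff₀ hτ]; linarith
  have hQ1 : 1 ≤ Q := Real.one_le_rpow h4τ (by positivity)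
  have hQ : Q ^ (d + 1) = 4 / τ := by
    rw [hQdef, ← Real.rpow_natCast, ← Real.rpow_mul (by positivity)]
    push_cast
    rw [one_div_mul_cancel (by positivity), Real.rpow_one]
  -- Frequency budget: `⌈N/2⌉` for the long factor, `⌈N/5⌉` for the shift, and the rest shared by
  -- `d` short factors of degree `q`, hence length `q + 1`. The requirement `2M ≤ N` uses `N ≥ 2`.
  obtain ⟨m, hm⟩ : ∃ m, m = (N + 1) / 2 := ⟨_, rfl⟩
  obtain ⟨M, hM⟩ : ∃ M, M = (N + 4) / 5 := ⟨_, rfl⟩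
  obtain ⟨q, hq⟩ : ∃ q, q = (N - M - m) / d := ⟨_, rfl⟩
  have hdq : d * q ≤ N - M - m := by rw [hq]; exact Nat.mul_div_le _ _
  have hdq' : N - M - m < d * (q + 1) := by
    rw [hq]; exact Nat.lt_mul_div_succ _ (by omega)
  have hK : (m - 1) + d * (q + 1 - 1) < N - M := by
    rw [Nat.add_sub_cancel]; omega
  have hs : 0 < 12 * d * Q / N := by positivity
  have hsep : ∀ t ∈ Ω, ∀ t' ∈ Ω, ¬ SameCluster Λ t t' → 12 * d * Q / N ≤ wrapDist t t' := by
    intro t ht t' ht' hc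
    have h1 := hρ.trans (h.clusterSep_le_of_not_sameCluster hN ht ht' hc)
    rw [div_le_iff₀' hN']
    exact_mod_cast h1
  have hfar : ∀ t ∈ Ω, ∑ k ∈ Finset.univ.filter fun k : Ω => ¬ SameCluster Λ t (k : Fin d → ℝ),
      ‖prodKernel (weight d m (q + 1)) (N - M) (node t) (node (k : Fin d → ℝ))‖ ≤ τ / 6 := by
    intro t ht
    rcases (Finset.univ.filter fun k : Ω => ¬ SameCluster Λ t (k : Fin d → ℝ)).eq_empty_or_nonempty
      with he | ⟨k, hk⟩
    · rw [he, Finset.sum_empty]; positivity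
    -- A far node is at distance at most `1/2`, so `12dQ/N ≤ 1/2`. For such `N`, rounding does not
    -- spoil `N ≤ 4d(q + 1)`.
    have hN24 : 24 ≤ N := by
      have h1 := (hsep t ht k k.2 (Finset.mem_filter.1 hk).2).trans (wrapDist_le_half _ _)
      rw [div_le_iff₀ hN'] at h1
      have h2 : (24 : ℝ) ≤ N := by nlinarith
      exact_mod_cast h2
    refine (sum_norm_prodKernel_far_le h hN hpair hd (by omega) (by omega) hK hs hsep ht _
      fun k hk => (Finset.mem_filter.1 hk).2).trans ?_
    exact two_mul_one_add_pow_sub_one_le hd hτ hτ1 (by positivity)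
      (kernel_const_le hd hN (by omega) (by omega) hτ (by positivity) hQ)
  obtain ⟨t₀, ht₀, -⟩ := h.exists_pair hpair
  have : Nonempty {v : EuclideanSpace ℂ Ω // ‖v‖ = 1} :=
    ⟨⟨EuclideanSpace.single ⟨t₀, ht₀⟩ 1, by simp⟩⟩
  refine le_ciInf fun ⟨v, hv⟩ => le_of_abs_le (abs_le_of_sq_le_sq ?_ (norm_nonneg _))
  have hmain := h.sum_norm_sq_le hN hpair hd (M := M) (K := N - M) (m := m) (m' := q + 1)
    (by omega) (by omega) (by omega) (by omega) (by omega) hK hfar v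
  have hv1 : ∑ j, ‖v j‖ ^ 2 = 1 := by
    rw [← EuclideanSpace.norm_sq_eq, hv, one_pow]
  rw [sq_bound_eq, norm_sq_conjTranspose_mulVec, ← hNn]
  rw [hv1, ← hτdef] at hmain
  set T := ∑ α ∈ multiBox d N, ‖∑ k : Ω, v k * conj (monom (node (k : Fin d → ℝ)) α)‖ ^ 2
  have hT : 0 ≤ T := Finset.sum_nonneg fun _ _ => sq_nonneg _
  set D := (d : ℝ) ^ ((d : ℝ) / 2)
  have hD : (d : ℝ) ≤ D := natCast_le_rpow_half hd
  have hD0 : 0 < D := by positivity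
  rw [div_le_iff₀ (by positivity)]
  have h1 : 2 * (5 / (4 * τ)) ^ 2 * (1 + d) * (13 / 6 * (2 / (N : ℝ)) ^ d) * T =
      (325 / 48 * (1 + d) * 2 ^ d * T) / (τ ^ 2 * N ^ d) := by
    rw [div_pow, div_pow]
    field_simp
    ring
  rw [h1, le_div_iff₀ (by positivity)] at hmain
  -- The numerical margin is `(49/144)(48/325)/2 = 49/1950 > 1/72`.
  have h2 : (1 + d) * (2 ^ d * T) ≤ 2 * D * (2 ^ d * T) :=
    mul_le_mul_of_nonneg_right (by linarith) (by positivity)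
  have h3 : 0 ≤ D * (2 ^ d * T) := by positivity
  nlinarith

end Main

end ClusteredVandermonde

theorem mainTheorem4 (d n L : ℕ) (hd : 1 ≤ d) (Ω : Finset (Fin d → ℝ))
    (hcard : Ω.card < (n + 1) ^ d)
    (Λ : Fin L → Finset (Fin d → ℝ))
    (hΩ : ClusteredVandermonde.IsClusteredConfiguration (n + 1) Ω Λ)
    (hpair : ClusteredVandermonde.maxClusterCard Λ = 2) :
    ClusteredVandermonde.clusterComplexity (n + 1) Ω =
        1 / ClusteredVandermonde.minSep (n + 1) Ω ∧
      (((12 * (d : ℝ) * (4 / ClusteredVandermonde.minSep (n + 1) Ω) ^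
            (1 / ((d : ℝ) + 1)) : ℝ) : EReal) ≤ ClusteredVandermonde.clusterSep (n + 1) Λ →
        ClusteredVandermonde.minSep (n + 1) Ω * ((n + 1 : ℕ) : ℝ) ^ ((d : ℝ) / 2) /
            (12 * (2 : ℝ) ^ ((d : ℝ) / 2 - 1 / 2) * (d : ℝ) ^ ((d : ℝ) / 4)) ≤
          ClusteredVandermonde.sigmaMin (ClusteredVandermonde.vandermonde n Ω)) := by
  refine ⟨hΩ.clusterComplexity_eq n.succ_pos hpair, fun hρ =>
    ClusteredVandermonde.le_sigmaMin_vandermonde_of_pairs hd ?_ hΩ hpair hρ⟩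
  -- For `n = 0` the cardinality bound would leave no node at all.
  obtain ⟨t, ht, -⟩ := hΩ.exists_pair hpair
  have h1 : 0 < Ω.card := Finset.card_pos.2 ⟨t, ht⟩
  by_contra hn
  obtain rfl : n = 0 := by omega
  rw [zero_add, one_pow] at hcard
  omega
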